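/- Let $F$ be a free group of finite rank $k\ge 1$ with a fixed free basis $\Sigma$; for $g\in F$ let $|g|$ be the length of its freely reduced word in $\Sigma\cup\Sigma^{-1}$. Let $\partial F$ be the boundary at infinity of $F$, that is, the set of freely reduced right-infinite words in $\Sigma\cup\Sigma^{-1}$, with the topology generated by the cylinders (sets of all infinite words with a given initial segment), and let $\partial^2F=\{(p,q)\in\partial F\times\partial F: p\neq q\}$ with the topology induced from the product, identified with the set of oriented bi-infinite geodesics of the Cayley graph of $F$ with respect to $\Sigma$. Every $\Phi\in\mathrm{Aut}(F)$ extends to a homeomorphism of $\partial F$ and so acts on $\partial^2F$ by $\Phi\times\Phi$; $F$ acts on $\partial^2 F$ through the inner automorphisms. A geodesic current is an $F$-invariant non-negative Borel measure on $\partial^2F$ that is finite on compact sets, and its length $L(\eta)=\eta(B)$ is the measure of the set $B$ of all geodesics passing through the vertex $1$. Then there is exactly one geodesic current $\eta_A$ (the uniform current) such that, for all $x\ne y$ in $F$, the set of geodesics that pass through the oriented segment from $x$ to $y$ has $\eta_A$-measure $$\frac{1}{2k(2k-1)^{|x^{-1}y|-1}} .$$ For $\Phi\in\mathrm{Aut}(F)$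 define its length by $L(\Phi)=L\big((\Phi\times\Phi)_*\eta_A\big)$. The spectrum $$\{L(\Phi):\Phi\in\mathrm{Aut}(F)\}$$ of the length function is a closed discrete subset of $\mathbb R$; equivalently, it has no accumulation point in $\mathbb R$. -/

import Mathlib

open MeasureTheory Filter Topology

namespace FreeCurrents

/-! Throughout, `S` is a finite free basis of `F = FreeGroup S`, a letter is an element of
`S × Bool` (`(s, true)` is `s`, `(s, false)` is `s⁻¹`), `g.toWord` is the freely reduced word of
`g : F` and `g.norm` is its length. -/

/-- The boundary at infinity of the free group on `S`: the set of freely reduced right-infinite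
words (equivalently, of geodesic rays issuing from `1` in the Cayley graph). -/
def Boundary (S : Type*) : Type _ :=
  {x : ℕ → S × Bool // ∀ n, (x n).1 = (x (n + 1)).1 → (x n).2 = (x (n + 1)).2}

variable {S : Type*}

/-- The `n`-th letter of a ray. -/
def Boundary.letter (x : Boundary S) (n : ℕ) : S × Bool := x.1 n

/-- The initial segment of length `n` of a ray, as an element of the free group. -/
def Boundary.take (x : Boundary S) (n : ℕ) : FreeGroup S :=
  FreeGroup.mk ((List.range n).map x.letter)

theorem Boundary.take_succ (x : Boundary S) (n : ℕ) :
    x.take (n + 1) = x.take n * FreeGroup.mk [x.letter n] := by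
  rw [Boundary.take, Boundary.take, FreeGroup.mul_mk, List.range_succ, List.map_append]
  rfl

theorem Boundary.isReduced_map_range (x : Boundary S) (n : ℕ) :
    FreeGroup.IsReduced ((List.range n).map x.letter) := by
  rw [FreeGroup.IsReduced, List.isChain_iff_getElem]
  intro i hi
  simp only [List.getElem_map, List.getElem_range]
  exact x.2 i

variable [DecidableEq S]

/-- The cylinder of `v` in the boundary: the set of rays having `v` as initial segment. -/
def cyl (v : FreeGroup S) : Set (Boundary S) :=
  {x | ∀ (i : ℕ) (hi : i < v.toWord.length), x.letter i = v.toWord[i]}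

/-- The topology of the boundary, generated by the cylinders. -/
instance : TopologicalSpace (Boundary S) :=
  TopologicalSpace.generateFrom (Set.range (cyl (S := S)))

/-- A sequence `u` in the free group converges to the boundary point `x`: for every `m`, the
`m`-th letter of `u n` is eventually defined and equal to that of `x`. -/
def ConvergesTo (u : ℕ → FreeGroup S) (x : Boundary S) : Prop :=
  ∀ m, ∀ᶠ n in atTop, (u n).toWord[m]? = some (x.letter m)

/-! ### The action of automorphisms on the boundary -/

theorem getElem?_toWord_mul_mk_singleton (g : FreeGroup S) (a : S × Bool) {m : ℕ}
    (hm : m + 1 < g.norm + 1) :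
    g.norm ≤ (g * FreeGroup.mk [a]).norm + 1 ∧
      ((g * FreeGroup.mk [a]).norm ≤ m ∨
        (g * FreeGroup.mk [a]).toWord[m]? = g.toWord[m]?) := by
  have hred : FreeGroup.IsReduced g.toWord := FreeGroup.isReduced_toWord
  have hg : g = FreeGroup.mk g.toWord := FreeGroup.mk_toWord.symm
  have hnorm : g.norm = g.toWord.length := rfl
  rcases List.eq_nil_or_concat g.toWord with h | ⟨L, b, h⟩
  · rw [hnorm, h] at hm
    simp at hm
  rw [List.concat_eq_append] at h
  by_cases hab : b.1 = a.1 ∧ b.2 = !a.2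
  · have hprod : g * FreeGroup.mk [a] = FreeGroup.mk L := by
      rw [hg, h, FreeGroup.mul_mk]
      obtain ⟨b1, b2⟩ := b
      obtain ⟨a1, a2⟩ := a
      obtain ⟨h1, h2⟩ := hab
      simp only at h1 h2
      subst h1 h2
      refine FreeGroup.Red.exact.2 ⟨L, ?_, Relation.ReflTransGen.refl⟩
      have := @FreeGroup.Red.Step.not _ L [] b1 (!a2)
      simp only [Bool.not_not, List.append_nil] at this
      rw [List.append_assoc]
      exact Relation.ReflTransGen.single this
    have hL : FreeGroup.IsReduced L := hred.infix ⟨[], [b], by simp [h]⟩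
    have hw : (g * FreeGroup.mk [a]).toWord = L := by
      rw [hprod, FreeGroup.toWord_mk, hL.reduce_eq]
    refine ⟨?_, ?_⟩
    · simp [FreeGroup.norm, hw, h]
    · simp only [FreeGroup.norm, hw, h]
      by_cases hmL : m < L.length
      · right
        rw [List.getElem?_append_left hmL]
      · left
        omega
  · have hL : FreeGroup.IsReduced (g.toWord ++ [a]) := by
      have h2 : FreeGroup.IsReduced ([b] ++ [a]) := by
        simp only [List.cons_append, List.nil_append, FreeGroup.isReduced_cons_cons,
          FreeGroup.IsReduced.singleton, and_true]
        intro h1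
        by_contra h3
        exact hab ⟨h1, by
          revert h3
          cases b.2 <;> cases a.2 <;> simp⟩
      rw [h] at hred ⊢
      exact FreeGroup.IsReduced.append_overlap hred h2 (by simp)
    have hw : (g * FreeGroup.mk [a]).toWord = g.toWord ++ [a] := by
      conv_lhs => rw [hg, FreeGroup.mul_mk, FreeGroup.toWord_mk, hL.reduce_eq]
    refine ⟨?_, Or.inr ?_⟩
    · simp only [FreeGroup.norm, hw, List.length_append]
      omega
    · rw [hw, List.getElem?_append_left]
      omega

theorem getElem?_toWord_mul_mk (w : List (S × Bool)) (g : FreeGroup S) {m : ℕ}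
    (hm : m + w.length < g.norm) :
    (g * FreeGroup.mk w).toWord[m]? = g.toWord[m]? := by
  induction w generalizing g with
  | nil =>
    have : (FreeGroup.mk [] : FreeGroup S) = 1 := rfl
    rw [this, mul_one]
  | cons a w ih =>
    simp only [List.length_cons] at hm
    obtain ⟨h1, h2⟩ := getElem?_toWord_mul_mk_singleton g a (m := m) (by omega)
    have h3 : g * FreeGroup.mk (a :: w) = g * FreeGroup.mk [a] * FreeGroup.mk w := by
      rw [mul_assoc, FreeGroup.mul_mk]
      rfl
    rw [h3, ih _ (by omega)]
    rcases h2 with h2 | h2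
    · omega
    · exact h2

/-- Along a path of bounded step size `C` that stays outside the ball of radius `m + C`,
the `m`-th letter does not change. -/
theorem getElem?_toWord_path (u : ℕ → FreeGroup S) {C m a b : ℕ} (hab : a ≤ b)
    (hstep : ∀ j, ((u j)⁻¹ * u (j + 1)).norm ≤ C)
    (hfar : ∀ j, a ≤ j → j ≤ b → m + C < (u j).norm) :
    (u b).toWord[m]? = (u a).toWord[m]? := by
  induction b, hab using Nat.le_induction with
  | base => rfl
  | succ b hab ih =>
    rw [← ih (fun j h1 h2 => hfar j h1 (by omega))]
    have h1 : u (b + 1) = u b * FreeGroup.mk ((u b)⁻¹ * u (b + 1)).toWord := by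
      rw [FreeGroup.mk_toWord, mul_inv_cancel_left]
    rw [h1]
    apply getElem?_toWord_mul_mk
    have h2 := hstep b
    have h3 := hfar b hab (by omega)
    simp only [FreeGroup.norm] at h2 h3 ⊢
    omega

theorem exists_norm_le [Finite S] (Φ : MulAut (FreeGroup S)) :
    ∃ C : ℕ, ∀ g : FreeGroup S, (Φ g).norm ≤ C * g.norm := by
  obtain ⟨C, hC⟩ := (Set.finite_range fun a : S × Bool => (Φ (FreeGroup.mk [a])).norm).bddAbove
  refine ⟨C, fun g => ?_⟩
  have key : ∀ w : List (S × Bool), (Φ (FreeGroup.mk w)).norm ≤ C * w.length := by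
    intro w
    induction w with
    | nil =>
      have : (FreeGroup.mk [] : FreeGroup S) = 1 := rfl
      simp [this]
    | cons a w ih =>
      have h : (FreeGroup.mk (a :: w) : FreeGroup S) = FreeGroup.mk [a] * FreeGroup.mk w := by
        rw [FreeGroup.mul_mk]
        rfl
      have ha : (Φ (FreeGroup.mk [a])).norm ≤ C := hC ⟨a, rfl⟩
      rw [h, map_mul, List.length_cons, Nat.mul_succ]
      exact (FreeGroup.norm_mul_le _ _).trans (by omega)
  simpa [FreeGroup.norm, FreeGroup.mk_toWord] using key g.toWord

theorem Boundary.toWord_take (x : Boundary S) (n : ℕ) :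
    (x.take n).toWord = (List.range n).map x.letter := by
  rw [Boundary.take, FreeGroup.toWord_mk, (x.isReduced_map_range n).reduce_eq]

theorem Boundary.norm_take (x : Boundary S) (n : ℕ) : (x.take n).norm = n := by
  simp [FreeGroup.norm, x.toWord_take]

theorem norm_map_step_take [Finite S] (Φ : MulAut (FreeGroup S)) {C : ℕ}
    (hC : ∀ g : FreeGroup S, (Φ g).norm ≤ C * g.norm) (x : Boundary S) (j : ℕ) :
    ((Φ (x.take j))⁻¹ * Φ (x.take (j + 1))).norm ≤ C := by
  rw [x.take_succ, map_mul, inv_mul_cancel_left]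
  have h1 : (FreeGroup.mk [x.letter j]).norm ≤ 1 := FreeGroup.norm_mk_le
  calc _ ≤ C * (FreeGroup.mk [x.letter j]).norm := hC _
    _ ≤ C * 1 := Nat.mul_le_mul_left C h1
    _ = C := mul_one C

theorem eventually_lt_norm_map_take [Finite S] (Φ : MulAut (FreeGroup S)) (x : Boundary S)
    (M : ℕ) : ∃ N, ∀ n, N ≤ n → M < (Φ (x.take n)).norm := by
  obtain ⟨D, hD⟩ := exists_norm_le Φ⁻¹
  refine ⟨D * M + 1, fun n hn => ?_⟩
  by_contra! h
  have h1 := hD (Φ (x.take n))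
  rw [MulAut.inv_apply_self, x.norm_take] at h1
  have h2 : D * (Φ (x.take n)).norm ≤ D * M := Nat.mul_le_mul_left D h
  omega

/-- The images under `Φ` of the initial segments of a ray converge to a boundary point. -/
theorem exists_convergesTo [Finite S] (Φ : MulAut (FreeGroup S)) (x : Boundary S) :
    ∃ y : Boundary S, ConvergesTo (fun n => Φ (x.take n)) y := by
  obtain ⟨C, hC⟩ := exists_norm_le Φ
  have key : ∀ m : ℕ, ∃ (a : S × Bool) (N : ℕ), ∀ n : ℕ, N ≤ n →
      (Φ (x.take n)).toWord[m]? = some a := by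
    intro m
    obtain ⟨N, hN⟩ := eventually_lt_norm_map_take Φ x (m + C)
    have hlen : m < (Φ (x.take N)).toWord.length := by
      have := hN N le_rfl
      simp only [FreeGroup.norm] at this
      omega
    refine ⟨(Φ (x.take N)).toWord[m], N, fun n hn => ?_⟩
    rw [getElem?_toWord_path (fun n => Φ (x.take n)) hn (norm_map_step_take Φ hC x)
      (fun j h1 _ => hN j h1), List.getElem?_eq_getElem hlen]
  choose y N hy using key
  refine ⟨⟨y, fun n => ?_⟩, fun m => eventually_atTop.2 ⟨N m, hy m⟩⟩
  set k := max (N n) (N (n + 1))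
  have h1 := hy n k (le_max_left _ _)
  have h2 := hy (n + 1) k (le_max_right _ _)
  have hred : FreeGroup.IsReduced (Φ (x.take k)).toWord := FreeGroup.isReduced_toWord
  rw [FreeGroup.IsReduced, List.isChain_iff_getElem] at hred
  obtain ⟨h3, h4⟩ := List.getElem?_eq_some_iff.1 h1
  obtain ⟨h5, h6⟩ := List.getElem?_eq_some_iff.1 h2
  have := hred n h5
  rwa [h4, h6] at this

theorem ConvergesTo.unique {u : ℕ → FreeGroup S} {x y : Boundary S} (hx : ConvergesTo u x)
    (hy : ConvergesTo u y) : x = y := by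
  refine Subtype.ext (funext fun m => ?_)
  obtain ⟨n, h1, h2⟩ := ((hx m).and (hy m)).exists
  exact Option.some.inj (h1.symm.trans h2)

/-- The extension of an automorphism `Φ` of the free group to the boundary: the image of a ray
`x` is the limit of the elements `Φ (x.take n)`. -/
noncomputable def boundaryMap [Finite S] (Φ : MulAut (FreeGroup S)) (x : Boundary S) :
    Boundary S :=
  (exists_convergesTo Φ x).choose

theorem boundaryMap_spec [Finite S] (Φ : MulAut (FreeGroup S)) (x : Boundary S) :
    ConvergesTo (fun n => Φ (x.take n)) (boundaryMap Φ x) :=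
  (exists_convergesTo Φ x).choose_spec

theorem boundaryMap_inv_boundaryMap [Finite S] (Φ : MulAut (FreeGroup S)) (x : Boundary S) :
    boundaryMap Φ⁻¹ (boundaryMap Φ x) = x := by
  refine (boundaryMap_spec Φ⁻¹ (boundaryMap Φ x)).unique fun m => ?_
  obtain ⟨C, hC⟩ := exists_norm_le Φ⁻¹
  obtain ⟨D, hD⟩ := exists_norm_le Φ
  set y := boundaryMap Φ x with hy
  have hlow : ∀ g : FreeGroup S, g.norm ≤ D * (Φ⁻¹ g).norm := by
    intro g
    have := hD (Φ⁻¹ g)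
    rwa [MulAut.apply_inv_self] at this
  refine eventually_atTop.2 ⟨D * (m + C) + 1, fun n hn => ?_⟩
  -- a far initial segment of `x` whose image starts with `y.take n`
  have hagree : ∀ᶠ k in atTop, ∀ i ∈ Set.Iio n,
      (Φ (x.take k)).toWord[i]? = some (y.letter i) :=
    (eventually_all_finite (Set.finite_Iio n)).2 fun i _ => boundaryMap_spec Φ x i
  obtain ⟨N, hN⟩ := eventually_lt_norm_map_take Φ x n
  obtain ⟨k, hk, hkm, hkN⟩ :=
    (hagree.and ((eventually_gt_atTop m).and (eventually_ge_atTop N))).exists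
  set L := (Φ (x.take k)).toWord with hLdef
  have hLred : FreeGroup.IsReduced L := FreeGroup.isReduced_toWord
  have hLlen : n < L.length := hN k hkN
  have htake : y.take n = FreeGroup.mk (L.take n) := by
    rw [Boundary.take]
    congr 1
    refine List.ext_getElem (by simp; omega) fun i h1 h2 => ?_
    have h3 : i < n := by simpa using h1
    have := hk i h3
    rw [List.getElem?_eq_getElem (by omega)] at this
    simpa using (Option.some.inj this).symm
  have hxk : x.take k = Φ⁻¹ (FreeGroup.mk (L.take L.length)) := by
    rw [List.take_length, hLdef, FreeGroup.mk_toWord, MulAut.inv_apply_self]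
  have hnormtake : ∀ j, j ≤ L.length → (FreeGroup.mk (L.take j) : FreeGroup S).norm = j := by
    intro j hj
    have h1 : FreeGroup.IsReduced (L.take j) := hLred.infix (List.take_prefix j L).isInfix
    rw [FreeGroup.norm, FreeGroup.toWord_mk, h1.reduce_eq, List.length_take]
    omega
  have hpath := getElem?_toWord_path (fun j => Φ⁻¹ (FreeGroup.mk (L.take j) : FreeGroup S))
    (C := C) (m := m) hLlen.le
    (fun j => by
      have h1 : ((FreeGroup.mk (L.take j) : FreeGroup S)⁻¹ *
          FreeGroup.mk (L.take (j + 1))).norm ≤ 1 := by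
        rw [List.take_add_one, ← FreeGroup.mul_mk, inv_mul_cancel_left]
        refine FreeGroup.norm_mk_le.trans ?_
        cases L[j]? <;> simp
      rw [← map_inv, ← map_mul]
      exact (hC _).trans ((Nat.mul_le_mul_left C h1).trans_eq (mul_one C)))
    (fun j h1 h2 => by
      by_contra! h
      have h3 := hlow (FreeGroup.mk (L.take j))
      rw [hnormtake j h2] at h3
      have h4 := Nat.mul_le_mul_left D h
      omega)
  simp only at hpath ⊢
  rw [htake, ← hpath, ← hxk, x.toWord_take]
  simp [hkm]

theorem boundaryMap_injective [Finite S] (Φ : MulAut (FreeGroup S)) :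
    Function.Injective (boundaryMap Φ) :=
  Function.LeftInverse.injective (boundaryMap_inv_boundaryMap Φ)

/-! ### The double boundary, currents and lengths -/

/-- The double boundary `∂²F`: ordered pairs of distinct boundary points, with the topology
induced from the product (i.e. the space of oriented bi-infinite geodesics). -/
abbrev DoubleBoundary (S : Type*) [DecidableEq S] : Type _ :=
  {p : Boundary S × Boundary S // p.1 ≠ p.2}

instance : MeasurableSpace (DoubleBoundary S) := borel _

instance : BorelSpace (DoubleBoundary S) := ⟨rfl⟩

/-- The diagonal action `Φ × Φ` of an automorphism on the double boundary. -/
noncomputable def doubleBoundaryMap [Finite S] (Φ : MulAut (FreeGroup S))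
    (p : DoubleBoundary S) : DoubleBoundary S :=
  ⟨(boundaryMap Φ p.1.1, boundaryMap Φ p.1.2), fun h => p.2 (boundaryMap_injective Φ h)⟩

/-- `γ : ℤ → F` is the sequence of vertices of the oriented bi-infinite geodesic of the Cayley
graph (whose distance is `(g, h) ↦ |g⁻¹ h|`) with ends `p = (γ(-∞), γ(+∞))`. -/
def IsGeodesic (γ : ℤ → FreeGroup S) (p : DoubleBoundary S) : Prop :=
  (∀ i j : ℤ, ((γ i)⁻¹ * γ j).norm = (j - i).natAbs) ∧
    ConvergesTo (fun n : ℕ => γ (-(n : ℤ))) p.1.1 ∧ ConvergesTo (fun n : ℕ => γ n) p.1.2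

/-- The cylinder of `[x, y]` in the double boundary: the geodesics that pass through the oriented
segment from `x` to `y`. For `x = y` these are the geodesics through the vertex `x`. -/
def segmentCyl (x y : FreeGroup S) : Set (DoubleBoundary S) :=
  {p | ∃ γ : ℤ → FreeGroup S, IsGeodesic γ p ∧ ∃ i j : ℤ, i ≤ j ∧ γ i = x ∧ γ j = y}

/-- The base-ball: the set of geodesics passing through `1`. -/
def baseBall (S : Type*) [DecidableEq S] : Set (DoubleBoundary S) := segmentCyl 1 1

/-- A geodesic current: a Borel measure on the double boundary, finite on compact sets and
invariant under `F`, which acts through inner automorphisms `h ↦ g h g⁻¹`. -/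
structure IsCurrent [Finite S] (η : Measure (DoubleBoundary S)) : Prop where
  finite_on_compact : IsFiniteMeasureOnCompacts η
  invariant : ∀ g : FreeGroup S, η.map (doubleBoundaryMap (MulAut.conj g)) = η

/-- The length of a current: the mass of the base-ball. -/
noncomputable def currentLength (η : Measure (DoubleBoundary S)) : ℝ := η.real (baseBall S)

/-- `η` is the uniform current: the current giving the cylinder of `[x, y]`, `x ≠ y`, the mass
`μ (cyl (x⁻¹ y)) = 1 / (2k (2k-1)^(|x⁻¹ y| - 1))`, where `k` is the rank and `μ` is the uniform
probability measure on the boundary. -/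
structure IsUniformCurrent [Fintype S] (η : Measure (DoubleBoundary S)) : Prop where
  isCurrent : IsCurrent η
  segmentCyl_eq : ∀ x y : FreeGroup S, x ≠ y →
    η (segmentCyl x y) = ENNReal.ofReal
      (1 / (2 * Fintype.card S * (2 * Fintype.card S - 1) ^ ((x⁻¹ * y).norm - 1)))

/-- The length of an automorphism `Φ` with respect to a current `η`: the length of the current
`Φ η = (Φ × Φ)_* η`. For `η` the uniform current, this is the length `L(Φ)`. -/
noncomputable def autLength [Finite S] (η : Measure (DoubleBoundary S))
    (Φ : MulAut (FreeGroup S)) : ℝ :=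
  currentLength (η.map (doubleBoundaryMap Φ))

end FreeCurrents

set_option linter.unusedSectionVars false

namespace FreeCurrents

section

variable {S : Type*} [DecidableEq S]

/-! ### Words and prefixes -/

/-! Write q = 2k - 1 and let μ be the uniform probability measure on the boundary. On pairs of rays
whose common initial segment has length n, the uniform current is (q+1)/q · q^(2n) · (μ × μ). A
rectangle of disjoint cylinders of u and v then has a mass depending only on |u⁻¹v|
(`uniformCurrent_rect`), which gives invariance. Such rectangles are segment cylinders and form a
countable π-system generating the Borel sets, which gives uniqueness.

For the spectrum, it suffices that only finitely many lengths lie below each bound C. Invariance of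
the current makes L(Φ) unchanged under composition with inner automorphisms (`autLength_conj_mul`),
so Φ may be assumed balanced: no first-letter cylinder has mass above 1/2 for Φ_*μ
(`exists_isBalanced`). The claim is then |Φ(a)| ≤ const · L(Φ) for every letter a
(`IsBalanced.norm_letter_le`), and only finitely many automorphisms have images of the basis of
bounded length.

To prove the claim, let b be the i-th letter of w = Φ(a), let wᵢ be the initial segment of w before
it, and put v = Φ⁻¹(wᵢ⁻¹). Let U be the set of rays whose image under Φ starts with b. Balancedness
forces the harmonic measure of U to be at most 1/2 seen from v and at least 1/2 seen from va. An
edge along which harmonic measure crosses 1/2 cannot have nearly all forward directions inside U or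
nearly all outside U, so a definite mass of geodesics with apex at its endpoint nearer to 1 runs
from the complement of U to U (`le_uniformCurrent_of_crossing`). Their images under Φ leave 1 in two
different directions, so they all count in L(Φ), and geodesics with different apexes are disjoint.
Since distinct i give distinct v, the length of w is bounded by a multiple of L(Φ).

The crossing argument needs q ≥ 3. In rank one every geodesic passes through 1, so L is constant. -/

theorem toWord_mk_of_isReduced {L : List (S × Bool)} (h : FreeGroup.IsReduced L) :
    (FreeGroup.mk L).toWord = L := by
  rw [FreeGroup.toWord_mk, h.reduce_eq]

theorem head?_toWord_inv (g : FreeGroup S) :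
    g⁻¹.toWord.head? = g.toWord.getLast?.map fun b => (b.1, !b.2) := by
  rw [FreeGroup.toWord_inv, FreeGroup.invRev, List.head?_reverse, List.getLast?_map]

theorem isReduced_toWord_append_iff {g : FreeGroup S} {L : List (S × Bool)}
    (hL : FreeGroup.IsReduced L) :
    FreeGroup.IsReduced (g.toWord ++ L) ↔ ∀ b ∈ L.head?, g⁻¹.toWord.head? ≠ some b := by
  rw [FreeGroup.IsReduced, List.isChain_append, head?_toWord_inv]
  have h1 : FreeGroup.IsReduced g.toWord := FreeGroup.isReduced_toWord
  constructor
  · rintro ⟨-, -, h⟩ b hb hc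
    obtain ⟨a, ha, rfl⟩ := Option.map_eq_some_iff.1 hc
    have := h a ha _ hb rfl
    simp at this
  · refine fun h => ⟨h1, hL, fun a ha b hb hab => ?_⟩
    by_contra hne
    refine h b hb (Option.map_eq_some_iff.2 ⟨a, ha, ?_⟩)
    refine Prod.ext hab ?_
    revert hne
    cases a.2 <;> cases b.2 <;> simp

theorem toWord_mul_mk_of_head? {g : FreeGroup S} {L : List (S × Bool)}
    (hL : FreeGroup.IsReduced L) (h : ∀ b ∈ L.head?, g⁻¹.toWord.head? ≠ some b) :
    (g * FreeGroup.mk L).toWord = g.toWord ++ L := by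
  have h1 := (isReduced_toWord_append_iff hL).2 h
  conv_lhs => rw [← FreeGroup.mk_toWord (x := g), FreeGroup.mul_mk]
  exact toWord_mk_of_isReduced h1

theorem toWord_mul_of_head? {g h : FreeGroup S}
    (H : ∀ b ∈ h.toWord.head?, g⁻¹.toWord.head? ≠ some b) :
    (g * h).toWord = g.toWord ++ h.toWord := by
  conv_lhs => rw [← FreeGroup.mk_toWord (x := h)]
  exact toWord_mul_mk_of_head? FreeGroup.isReduced_toWord H

/-- The initial segment of length `j` of an element of the free group. -/
def initSeg (g : FreeGroup S) (j : ℕ) : FreeGroup S := FreeGroup.mk (g.toWord.take j)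

theorem toWord_initSeg (g : FreeGroup S) (j : ℕ) : (initSeg g j).toWord = g.toWord.take j :=
  toWord_mk_of_isReduced
    (FreeGroup.isReduced_toWord.infix (List.take_prefix j _).isInfix)

theorem norm_initSeg {g : FreeGroup S} {j : ℕ} (h : j ≤ g.norm) : (initSeg g j).norm = j := by
  rw [FreeGroup.norm] at h
  rw [FreeGroup.norm, toWord_initSeg, List.length_take]
  omega

theorem initSeg_norm (g : FreeGroup S) : initSeg g g.norm = g := by
  rw [initSeg, FreeGroup.norm, List.take_length, FreeGroup.mk_toWord]

theorem norm_inv_initSeg_mul_le (g : FreeGroup S) (j : ℕ) :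
    ((initSeg g j)⁻¹ * initSeg g (j + 1)).norm ≤ 1 := by
  rw [initSeg, initSeg, List.take_add_one, ← FreeGroup.mul_mk, inv_mul_cancel_left]
  refine FreeGroup.norm_mk_le.trans ?_
  cases g.toWord[j]? <;> simp

theorem Boundary.getElem?_toWord_take (x : Boundary S) {i n : ℕ} (h : i < n) :
    (x.take n).toWord[i]? = some (x.letter i) := by
  simp [x.toWord_take, h]

theorem Boundary.ext_letter {x y : Boundary S} (h : ∀ i, x.letter i = y.letter i) : x = y :=
  Subtype.ext (funext h)

theorem Boundary.take_eq_take_iff {x y : Boundary S} {n : ℕ} :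
    x.take n = y.take n ↔ ∀ i < n, x.letter i = y.letter i := by
  rw [← FreeGroup.toWord_inj, x.toWord_take, y.toWord_take]
  simp

theorem mem_cyl_iff_getElem? {v : FreeGroup S} {x : Boundary S} :
    x ∈ cyl v ↔ ∀ i < v.norm, v.toWord[i]? = some (x.letter i) := by
  constructor
  · intro h i hi
    rw [List.getElem?_eq_getElem hi, h i hi]
  · intro h i hi
    have := h i hi
    rw [List.getElem?_eq_getElem hi] at this
    exact (Option.some.inj this).symm

theorem mem_cyl_iff_take {v : FreeGroup S} {x : Boundary S} :
    x ∈ cyl v ↔ x.take v.norm = v := by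
  rw [mem_cyl_iff_getElem?, ← FreeGroup.toWord_inj]
  constructor
  · intro h
    refine List.ext_getElem? fun i => ?_
    by_cases hi : i < v.norm
    · rw [h i hi, x.getElem?_toWord_take hi]
    · rw [List.getElem?_eq_none, List.getElem?_eq_none]
      · simpa [FreeGroup.norm] using hi
      · rw [← FreeGroup.norm, x.norm_take]; omega
  · intro h i hi
    rw [← h, x.getElem?_toWord_take hi]

theorem Boundary.mem_cyl_take (x : Boundary S) (n : ℕ) : x ∈ cyl (x.take n) := by
  rw [mem_cyl_iff_take, x.norm_take]

theorem mem_cyl_take_iff {x y : Boundary S} {n : ℕ} :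
    x ∈ cyl (y.take n) ↔ ∀ i < n, x.letter i = y.letter i := by
  rw [mem_cyl_iff_take, y.norm_take, Boundary.take_eq_take_iff]

@[simp] theorem cyl_one : cyl (1 : FreeGroup S) = Set.univ := by
  ext x
  simp only [mem_cyl_iff_take, FreeGroup.norm_one, Set.mem_univ, iff_true]
  rfl

/-- The letter `a` as an element of the free group. -/
abbrev letterElt (a : S × Bool) : FreeGroup S := FreeGroup.mk [a]

@[simp] theorem toWord_letterElt (a : S × Bool) : (letterElt a).toWord = [a] :=
  toWord_mk_of_isReduced FreeGroup.IsReduced.singleton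

@[simp] theorem norm_letterElt (a : S × Bool) : (letterElt a).norm = 1 := by
  simp [FreeGroup.norm]

theorem letterElt_inv (a : S × Bool) : (letterElt a)⁻¹ = letterElt (a.1, !a.2) := by
  simp [letterElt, FreeGroup.inv_mk, FreeGroup.invRev]

theorem mem_cyl_letterElt {a : S × Bool} {x : Boundary S} :
    x ∈ cyl (letterElt a) ↔ x.letter 0 = a := by
  rw [mem_cyl_iff_getElem?]
  simp [eq_comm]

/-! ### Convergence and the boundary maps -/

theorem Boundary.convergesTo_take (x : Boundary S) : ConvergesTo x.take x := fun m =>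
  (eventually_gt_atTop m).mono fun _ hn => x.getElem?_toWord_take hn

theorem ConvergesTo.eventually_lt_norm {u : ℕ → FreeGroup S} {x : Boundary S}
    (h : ConvergesTo u x) (m : ℕ) : ∀ᶠ n in atTop, m < (u n).norm :=
  (h m).mono fun _ hn => (List.getElem?_eq_some_iff.1 hn).1

/-- Right multiplication by g disturbs only letters near the end of a long word. Hence conjugation
by g acts on the boundary as left translation (`ConvergesTo.mul_left`). -/
theorem ConvergesTo.mul_right {u : ℕ → FreeGroup S} {x : Boundary S}
    (h : ConvergesTo u x) (g : FreeGroup S) : ConvergesTo (fun n => u n * g) x := by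
  intro m
  filter_upwards [h m, h.eventually_lt_norm (m + g.norm)] with n h1 h2
  rw [← h1]
  conv_lhs => rw [← FreeGroup.mk_toWord (x := g)]
  exact getElem?_toWord_mul_mk _ _ h2

theorem ConvergesTo.eventually_agree {u : ℕ → FreeGroup S} {x : Boundary S}
    (h : ConvergesTo u x) (N : ℕ) :
    ∀ᶠ n in atTop, ∀ i < N, (u n).toWord[i]? = some (x.letter i) :=
  (eventually_all_finite (Set.finite_Iio N)).2 fun i _ => h i

/-- The images of the initial segments of g form a path of step at most C. If |h| ≤ D |Φ h| for all
h, this path is outside the ball of radius m + C from time D(m + C) + 1 on, so its m-th letter is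
frozen there. The bound does not depend on g. -/
theorem exists_getElem?_map_eq_initSeg [Finite S] (Φ : MulAut (FreeGroup S)) (m : ℕ) :
    ∃ N, ∀ g : FreeGroup S, N ≤ g.norm →
      (Φ g).toWord[m]? = (Φ (initSeg g N)).toWord[m]? := by
  obtain ⟨C, hC⟩ := exists_norm_le Φ
  obtain ⟨D, hD⟩ := exists_norm_le Φ⁻¹
  refine ⟨D * (m + C) + 1, fun g hg => ?_⟩
  have hpath := getElem?_toWord_path (fun j => Φ (initSeg g j)) (C := C) (m := m) hg
    (fun j => by
      rw [← map_inv, ← map_mul]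
      exact (hC _).trans
        ((Nat.mul_le_mul_left C (norm_inv_initSeg_mul_le g j)).trans_eq (mul_one C)))
    (fun j h1 h2 => by
      by_contra! h
      have h3 := hD (Φ (initSeg g j))
      rw [MulAut.inv_apply_self, norm_initSeg h2] at h3
      have h4 := Nat.mul_le_mul_left D h
      omega)
  simpa only [initSeg_norm] using hpath

theorem initSeg_eq_take {g : FreeGroup S} {y : Boundary S} {N : ℕ}
    (h : ∀ i < N, g.toWord[i]? = some (y.letter i)) : initSeg g N = y.take N := by
  rw [← FreeGroup.toWord_inj, toWord_initSeg]
  refine List.ext_getElem? fun i => ?_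
  by_cases hi : i < N
  · rw [List.getElem?_take_of_lt hi, h i hi, y.getElem?_toWord_take hi]
  · rw [List.getElem?_eq_none, List.getElem?_eq_none]
    · rw [← FreeGroup.norm, y.norm_take]; omega
    · simp; omega

/-- The `m`-th letter of the image of a long word or of a ray under `Φ` only depends on a
sufficiently long initial segment. -/
theorem exists_letter_boundaryMap [Finite S] (Φ : MulAut (FreeGroup S)) (m : ℕ) :
    ∃ N, ∀ (g : FreeGroup S) (y : Boundary S),
      (∀ i < N, g.toWord[i]? = some (y.letter i)) →
      (Φ g).toWord[m]? = some ((boundaryMap Φ y).letter m) := by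
  obtain ⟨N, hN⟩ := exists_getElem?_map_eq_initSeg Φ m
  have key : ∀ (g : FreeGroup S) (y : Boundary S),
      (∀ i < N, g.toWord[i]? = some (y.letter i)) →
      (Φ g).toWord[m]? = (Φ (y.take N)).toWord[m]? := by
    intro g y h
    rw [hN g, initSeg_eq_take h]
    by_contra! hlt
    have := h g.norm hlt
    simp [FreeGroup.norm] at this
  refine ⟨N, fun g y h => ?_⟩
  obtain ⟨n, h1, h2⟩ := ((boundaryMap_spec Φ y m).and (eventually_ge_atTop N)).exists
  rw [key g y h, ← h1, key (y.take n) y fun i hi => y.getElem?_toWord_take (by omega)]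

/-- This is uniform continuity of the boundary extension: N serves all rays at once. It is later
applied with M = 1 to control first letters. -/
theorem exists_boundaryMap_letter_eq [Finite S] (Φ : MulAut (FreeGroup S)) (M : ℕ) :
    ∃ N, ∀ x y : Boundary S, (∀ i < N, x.letter i = y.letter i) →
      ∀ m < M, (boundaryMap Φ x).letter m = (boundaryMap Φ y).letter m := by
  choose N hN using exists_letter_boundaryMap Φ
  refine ⟨(Finset.range M).sup N, fun x y h m hm => ?_⟩
  have hle : N m ≤ (Finset.range M).sup N := Finset.le_sup (Finset.mem_range.2 hm)
  have h1 := hN m (x.take (N m)) x fun i hi => x.getElem?_toWord_take hi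
  have h2 := hN m (x.take (N m)) y fun i hi => by
    rw [x.getElem?_toWord_take hi, h i (by omega)]
  exact Option.some.inj (h1.symm.trans h2)

theorem ConvergesTo.map [Finite S] {u : ℕ → FreeGroup S} {x : Boundary S}
    (h : ConvergesTo u x) (Φ : MulAut (FreeGroup S)) :
    ConvergesTo (fun n => Φ (u n)) (boundaryMap Φ x) := by
  intro m
  obtain ⟨N, hN⟩ := exists_letter_boundaryMap Φ m
  exact (h.eventually_agree N).mono fun n hn => hN _ _ hn

theorem boundaryMap_mul [Finite S] (Φ Ψ : MulAut (FreeGroup S)) (x : Boundary S) :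
    boundaryMap (Φ * Ψ) x = boundaryMap Φ (boundaryMap Ψ x) :=
  (boundaryMap_spec (Φ * Ψ) x).unique ((x.convergesTo_take.map Ψ).map Φ)

theorem boundaryMap_one [Finite S] (x : Boundary S) :
    boundaryMap (1 : MulAut (FreeGroup S)) x = x :=
  (boundaryMap_spec 1 x).unique x.convergesTo_take

/-- The action of the free group on its boundary by left translations. -/
noncomputable def translate [Finite S] (g : FreeGroup S) (x : Boundary S) : Boundary S :=
  boundaryMap (MulAut.conj g) x

/-! ### Left translation of rays and cancellation -/

section
variable [Finite S]

theorem translate_mul (g h : FreeGroup S) (x : Boundary S) :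
    translate (g * h) x = translate g (translate h x) := by
  rw [translate, map_mul, boundaryMap_mul]; rfl

theorem translate_one (x : Boundary S) : translate 1 x = x := by
  rw [translate, map_one, boundaryMap_one]

theorem translate_translate_inv (g : FreeGroup S) (x : Boundary S) :
    translate g (translate g⁻¹ x) = x := by
  rw [← translate_mul, mul_inv_cancel, translate_one]

theorem translate_injective (g : FreeGroup S) : Function.Injective (translate g) :=
  boundaryMap_injective _

theorem boundaryMap_translate (Φ : MulAut (FreeGroup S)) (g : FreeGroup S) (x : Boundary S) :
    boundaryMap Φ (translate g x) = translate (Φ g) (boundaryMap Φ x) := by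
  rw [translate, translate, ← boundaryMap_mul, ← boundaryMap_mul]
  congr 1
  ext h
  simp

theorem ConvergesTo.mul_left {u : ℕ → FreeGroup S} {x : Boundary S}
    (h : ConvergesTo u x) (g : FreeGroup S) :
    ConvergesTo (fun n => g * u n) (translate g x) := by
  have := (h.map (MulAut.conj g)).mul_right g
  simpa [translate] using this

theorem toWord_mul_take {w : FreeGroup S} {x : Boundary S}
    (h : w⁻¹.toWord.head? ≠ some (x.letter 0)) (n : ℕ) :
    (w * x.take n).toWord = w.toWord ++ (x.take n).toWord := by
  refine toWord_mul_of_head? fun b hb => ?_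
  rw [List.head?_eq_getElem?] at hb
  rcases Nat.eq_zero_or_pos n with rfl | hn
  · simp [Boundary.take] at hb
  · rw [x.getElem?_toWord_take hn] at hb
    rwa [← Option.some.inj hb]

theorem translate_letter_of_lt {w : FreeGroup S} {x : Boundary S}
    (h : w⁻¹.toWord.head? ≠ some (x.letter 0)) {i : ℕ} (hi : i < w.norm) :
    w.toWord[i]? = some ((translate w x).letter i) := by
  obtain ⟨n, hn⟩ := (x.convergesTo_take.mul_left w i).exists
  rwa [toWord_mul_take h, List.getElem?_append_left hi] at hn

theorem translate_letter_add {w : FreeGroup S} {x : Boundary S}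
    (h : w⁻¹.toWord.head? ≠ some (x.letter 0)) (i : ℕ) :
    (translate w x).letter (w.norm + i) = x.letter i := by
  obtain ⟨n, hn, hi⟩ :=
    ((x.convergesTo_take.mul_left w (w.norm + i)).and (eventually_gt_atTop i)).exists
  rw [toWord_mul_take h, FreeGroup.norm, List.getElem?_append_right (by omega),
    Nat.add_sub_cancel_left, x.getElem?_toWord_take hi] at hn
  exact (Option.some.inj hn).symm

end

/-- The tail of a ray, with the first `n` letters dropped. -/
def Boundary.drop (x : Boundary S) (n : ℕ) : Boundary S :=
  ⟨fun i => x.1 (n + i), fun i => x.2 (n + i)⟩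

theorem Boundary.letter_drop (x : Boundary S) (n i : ℕ) :
    (x.drop n).letter i = x.letter (n + i) := rfl

theorem Boundary.head?_inv_take_ne (x : Boundary S) (n : ℕ) :
    (x.take n)⁻¹.toWord.head? ≠ some (x.letter n) := by
  rw [head?_toWord_inv, x.toWord_take]
  rcases n with _ | n
  · simp
  · rw [List.range_succ, List.map_append]
    simp only [List.map_cons, List.map_nil, List.getLast?_append, List.getLast?_singleton,
      Option.some_or, Option.map_some, ne_eq, Option.some.injEq]
    intro h
    have h1 := x.2 n
    have h2 : (x.1 (n + 1)) = ((x.1 n).1, !(x.1 n).2) := h.symm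
    rw [h2] at h1
    simp at h1

theorem Boundary.translate_take_drop [Finite S] (x : Boundary S) (n : ℕ) :
    translate (x.take n) (x.drop n) = x := by
  have h : (x.take n)⁻¹.toWord.head? ≠ some ((x.drop n).letter 0) := x.head?_inv_take_ne n
  refine Boundary.ext_letter fun i => ?_
  by_cases hi : i < n
  · have := translate_letter_of_lt h (i := i) (by rwa [x.norm_take])
    rw [x.getElem?_toWord_take hi] at this
    exact (Option.some.inj this).symm
  · obtain ⟨j, rfl⟩ := Nat.exists_eq_add_of_le (not_lt.1 hi)
    have := translate_letter_add h j
    rwa [x.norm_take, letter_drop] at this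

/-- If x does not cancel into w, the translate is the concatenation of w and x. Conversely, if the
translate starts with w, removing w gives back x, and in a reduced ray the letter following w is not
inverse to the last letter of w. -/
theorem translate_mem_cyl_self_iff [Finite S] {w : FreeGroup S} {x : Boundary S} :
    translate w x ∈ cyl w ↔ w⁻¹.toWord.head? ≠ some (x.letter 0) := by
  constructor
  · intro h
    rw [mem_cyl_iff_take] at h
    set y := translate w x with hy
    have h1 := y.translate_take_drop w.norm
    have h2 := y.head?_inv_take_ne w.norm
    rw [h] at h1 h2
    have h3 : y.drop w.norm = x := translate_injective w h1
    rw [← h3]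
    exact h2
  · exact fun h => mem_cyl_iff_getElem?.2 fun i hi => translate_letter_of_lt h hi

/-- Translation by `g` maps the cylinder of `v` to that of `g v` if `g` does not cancel `v`
completely. -/
theorem translate_mem_cyl_mul_iff [Finite S] {g v : FreeGroup S} {x : Boundary S}
    (h : (g * v)⁻¹.toWord.head? = v⁻¹.toWord.head?) :
    translate g x ∈ cyl (g * v) ↔ x ∈ cyl v := by
  -- With x = v z, both sides say that z does not start with the inverse of the last letter, which
  -- is the same letter for v and for g v.
  obtain ⟨z, rfl⟩ : ∃ z, x = translate v z := ⟨translate v⁻¹ x, (translate_translate_inv v x).symm⟩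
  rw [← translate_mul, translate_mem_cyl_self_iff, translate_mem_cyl_self_iff, h]

end

section

variable {S : Type*} [DecidableEq S]

/-! ### The topology of the boundary and of the double boundary -/

theorem isOpen_cyl (v : FreeGroup S) : IsOpen (cyl v) :=
  TopologicalSpace.isOpen_generateFrom_of_mem ⟨v, rfl⟩

theorem cyl_take_subset {x : Boundary S} {v : FreeGroup S} (h : x ∈ cyl v) {n : ℕ}
    (hn : v.norm ≤ n) : cyl (x.take n) ⊆ cyl v := by
  intro y hy
  rw [mem_cyl_take_iff] at hy
  rw [mem_cyl_iff_getElem?] at h ⊢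
  intro i hi
  rw [h i hi, hy i (by omega)]

theorem cyl_subset_of_mem {x : Boundary S} {u v : FreeGroup S} (hu : x ∈ cyl u) (hv : x ∈ cyl v)
    (h : u.norm ≤ v.norm) : cyl v ⊆ cyl u := by
  conv_lhs => rw [← mem_cyl_iff_take.1 hv]
  exact cyl_take_subset hu h

theorem isTopologicalBasis_cyl :
    TopologicalSpace.IsTopologicalBasis (Set.range (cyl (S := S))) where
  exists_subset_inter := by
    rintro _ ⟨u, rfl⟩ _ ⟨v, rfl⟩ x ⟨hu, hv⟩
    exact ⟨_, ⟨x.take (max u.norm v.norm), rfl⟩, x.mem_cyl_take _,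
      Set.subset_inter (cyl_take_subset hu (le_max_left _ _))
        (cyl_take_subset hv (le_max_right _ _))⟩
  sUnion_eq := Set.eq_univ_of_univ_subset fun x _ => ⟨cyl 1, ⟨1, rfl⟩, by simp⟩
  eq_generateFrom := rfl

theorem isOpen_of_letter_determined {s : Set (Boundary S)}
    (h : ∀ x ∈ s, ∃ n, ∀ y : Boundary S, (∀ i < n, y.letter i = x.letter i) → y ∈ s) :
    IsOpen s := by
  refine isTopologicalBasis_cyl.isOpen_iff.2 fun x hx => ?_
  obtain ⟨n, hn⟩ := h x hx
  exact ⟨_, ⟨x.take n, rfl⟩, x.mem_cyl_take n, fun y hy => hn y (mem_cyl_take_iff.1 hy)⟩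

/-! ### Common initial segments, and rectangles of cylinders -/

/-- Pairs of rays whose longest common initial segment has length `n`. -/
def apexAt (S : Type*) (n : ℕ) : Set (Boundary S × Boundary S) :=
  {p | (∀ i < n, p.1.letter i = p.2.letter i) ∧ p.1.letter n ≠ p.2.letter n}

theorem disjoint_apexAt {m n : ℕ} (h : m ≠ n) : Disjoint (apexAt S m) (apexAt S n) := by
  rw [Set.disjoint_left]
  rintro p ⟨h1, h2⟩ ⟨h3, h4⟩
  rcases h.lt_or_gt with h | h
  · exact h2 (h3 _ h)
  · exact h4 (h1 _ h)

theorem exists_mem_apexAt {p : Boundary S × Boundary S} (h : p.1 ≠ p.2) :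
    ∃ n, p ∈ apexAt S n := by
  have hex : ∃ n, p.1.letter n ≠ p.2.letter n := by
    by_contra! hc
    exact h (Boundary.ext_letter hc)
  exact ⟨Nat.find hex, fun i hi => not_not.1 (Nat.find_min hex hi), Nat.find_spec hex⟩

theorem ne_of_mem_apexAt {p : Boundary S × Boundary S} {n : ℕ} (h : p ∈ apexAt S n) :
    p.1 ≠ p.2 := fun he => h.2 (by rw [he])

theorem isOpen_apexAt (n : ℕ) : IsOpen (apexAt S n) := by
  refine (isTopologicalBasis_cyl.prod isTopologicalBasis_cyl).isOpen_iff.2 fun p hp => ?_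
  refine ⟨_, ⟨_, ⟨p.1.take (n + 1), rfl⟩, _, ⟨p.2.take (n + 1), rfl⟩, rfl⟩,
    ⟨p.1.mem_cyl_take _, p.2.mem_cyl_take _⟩, ?_⟩
  rintro ⟨x, y⟩ ⟨hx, hy⟩
  rw [mem_cyl_take_iff] at hx hy
  refine ⟨fun i hi => ?_, ?_⟩
  · rw [hx i (by omega), hy i (by omega), hp.1 i hi]
  · simp only
    rw [hx n (by omega), hy n (by omega)]
    exact hp.2

theorem isOpen_ne : IsOpen {p : Boundary S × Boundary S | p.1 ≠ p.2} := by
  have : {p : Boundary S × Boundary S | p.1 ≠ p.2} = ⋃ n, apexAt S n := by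
    ext p
    simp only [Set.mem_ofPred_eq, Set.mem_iUnion]
    exact ⟨exists_mem_apexAt, fun ⟨n, hn⟩ => ne_of_mem_apexAt hn⟩
  rw [this]
  exact isOpen_iUnion isOpen_apexAt

/-- The geodesics with first end in the cylinder of `u` and second end in that of `v`. -/
def rect (u v : FreeGroup S) : Set (DoubleBoundary S) := {p | p.1.1 ∈ cyl u ∧ p.1.2 ∈ cyl v}

/-- The rectangles whose sides are disjoint cylinders of words of length at least `N`. -/
def rectFamily (S : Type*) [DecidableEq S] (N : ℕ) : Set (Set (DoubleBoundary S)) :=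
  {E | ∃ u v : FreeGroup S, N ≤ u.norm ∧ N ≤ v.norm ∧ Disjoint (cyl u) (cyl v) ∧ E = rect u v}

theorem isOpen_rect (u v : FreeGroup S) : IsOpen (rect u v) :=
  ((isOpen_cyl u).preimage (continuous_fst.comp continuous_subtype_val)).inter
    ((isOpen_cyl v).preimage (continuous_snd.comp continuous_subtype_val))

theorem exists_rect_take_subset {O : Set (DoubleBoundary S)} (hO : IsOpen O)
    {p : DoubleBoundary S} (hp : p ∈ O) :
    ∃ n₀, ∀ n, n₀ ≤ n → rect (p.1.1.take n) (p.1.2.take n) ⊆ O := by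
  obtain ⟨O', hO', rfl⟩ := isOpen_induced_iff.1 hO
  obtain ⟨_, ⟨_, ⟨u, rfl⟩, _, ⟨v, rfl⟩, rfl⟩, hpm, hsub⟩ :=
    (isTopologicalBasis_cyl.prod isTopologicalBasis_cyl).isOpen_iff.1 hO' p.1 hp
  refine ⟨max u.norm v.norm, fun n hn r hr => hsub ⟨?_, ?_⟩⟩
  · exact cyl_take_subset hpm.1 ((le_max_left _ _).trans hn) hr.1
  · exact cyl_take_subset hpm.2 ((le_max_right _ _).trans hn) hr.2

theorem disjoint_cyl_take {p : Boundary S × Boundary S} {m n : ℕ} (h : p ∈ apexAt S m)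
    (hn : m < n) : Disjoint (cyl (p.1.take n)) (cyl (p.2.take n)) := by
  rw [Set.disjoint_left]
  intro x h1 h2
  rw [mem_cyl_take_iff] at h1 h2
  exact h.2 ((h1 m hn).symm.trans (h2 m hn))

theorem isTopologicalBasis_rectFamily (N : ℕ) :
    TopologicalSpace.IsTopologicalBasis (rectFamily S N) := by
  refine TopologicalSpace.isTopologicalBasis_of_isOpen_of_nhds ?_ fun p O hp hO => ?_
  · rintro _ ⟨u, v, -, -, -, rfl⟩
    exact isOpen_rect u v
  · obtain ⟨n₀, hn₀⟩ := exists_rect_take_subset hO hp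
    obtain ⟨m, hm⟩ := exists_mem_apexAt p.2
    -- The three bounds make the rectangle fit in `O`, its sides long enough, and its sides
    -- disjoint.
    set n := max n₀ (max N (m + 1)) with hn
    refine ⟨_, ⟨p.1.1.take n, p.1.2.take n, ?_, ?_, disjoint_cyl_take hm (by omega), rfl⟩,
      ⟨p.1.1.mem_cyl_take n, p.1.2.mem_cyl_take n⟩, hn₀ n (by omega)⟩ <;>
    · rw [Boundary.norm_take]; omega

theorem isPiSystem_rectFamily (N : ℕ) : IsPiSystem (rectFamily S N) := by
  have key : ∀ (u u' : FreeGroup S), N ≤ u.norm → N ≤ u'.norm → (cyl u ∩ cyl u').Nonempty →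
      ∃ w : FreeGroup S, N ≤ w.norm ∧ cyl w = cyl u ∩ cyl u' := by
    rintro u u' hu hu' ⟨x, hx, hx'⟩
    rcases le_total u.norm u'.norm with h | h
    · exact ⟨u', hu', (Set.inter_eq_right.2 (cyl_subset_of_mem hx hx' h)).symm⟩
    · exact ⟨u, hu, (Set.inter_eq_left.2 (cyl_subset_of_mem hx' hx h)).symm⟩
  rintro _ ⟨u, v, hu, hv, hd, rfl⟩ _ ⟨u', v', hu', hv', hd', rfl⟩ ⟨p, hp, hp'⟩
  obtain ⟨w, hw, hwe⟩ := key u u' hu hu' ⟨p.1.1, hp.1, hp'.1⟩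
  obtain ⟨z, hz, hze⟩ := key v v' hv hv' ⟨p.1.2, hp.2, hp'.2⟩
  refine ⟨w, z, hw, hz, ?_, ?_⟩
  · rw [hwe, hze]
    exact hd.mono Set.inter_subset_left Set.inter_subset_left
  · ext r
    simp only [rect, hwe, hze, Set.mem_inter_iff, Set.mem_ofPred_eq]
    tauto

instance [Finite S] : Countable (FreeGroup S) :=
  (FreeGroup.toWord_injective (α := S)).countable

theorem countable_rectFamily [Finite S] (N : ℕ) : (rectFamily S N).Countable := by
  refine (Set.countable_range fun w : FreeGroup S × FreeGroup S => rect w.1 w.2).mono ?_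
  rintro _ ⟨u, v, -, -, -, rfl⟩
  exact ⟨(u, v), rfl⟩

instance [Finite S] : SecondCountableTopology (Boundary S) :=
  isTopologicalBasis_cyl.secondCountableTopology (Set.countable_range _)

instance : MeasurableSpace (Boundary S) := borel _

instance : BorelSpace (Boundary S) := ⟨rfl⟩

theorem measurableSet_cyl (v : FreeGroup S) : MeasurableSet (cyl v) :=
  (isOpen_cyl v).measurableSet

theorem measurableSet_letter (i : ℕ) (a : S × Bool) :
    MeasurableSet {x : Boundary S | x.letter i = a} :=
  (isOpen_of_letter_determined fun x hx => ⟨i + 1, fun y hy => by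
    rw [Set.mem_ofPred_eq, hy i (by omega)]; exact hx⟩).measurableSet

theorem measurableSet_apexAt [Finite S] (n : ℕ) : MeasurableSet (apexAt S n) :=
  (isOpen_apexAt n).measurableSet

theorem measurableEmbedding_val [Finite S] :
    MeasurableEmbedding (Subtype.val : DoubleBoundary S → Boundary S × Boundary S) := by
  have h : IsOpenEmbedding (Subtype.val : DoubleBoundary S → Boundary S × Boundary S) :=
    isOpen_ne.isOpenEmbedding_subtypeVal
  exact h.measurableEmbedding

theorem continuous_boundaryMap [Finite S] (Φ : MulAut (FreeGroup S)) :
    Continuous (boundaryMap Φ) := by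
  refine continuous_generateFrom_iff.2 ?_
  rintro _ ⟨v, rfl⟩
  refine isOpen_of_letter_determined fun x hx => ?_
  obtain ⟨N, hN⟩ := exists_boundaryMap_letter_eq Φ v.norm
  refine ⟨N, fun y hy => ?_⟩
  rw [Set.mem_preimage, mem_cyl_iff_getElem?] at hx ⊢
  intro i hi
  rw [hx i hi, hN y x hy i hi]

theorem measurable_boundaryMap [Finite S] (Φ : MulAut (FreeGroup S)) :
    Measurable (boundaryMap Φ) :=
  (continuous_boundaryMap Φ).measurable

theorem measurable_translate [Finite S] (g : FreeGroup S) :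
    Measurable (translate g : Boundary S → Boundary S) :=
  measurable_boundaryMap _

theorem continuous_doubleBoundaryMap [Finite S] (Φ : MulAut (FreeGroup S)) :
    Continuous (doubleBoundaryMap Φ) :=
  Continuous.subtype_mk
    (((continuous_boundaryMap Φ).comp (continuous_fst.comp continuous_subtype_val)).prodMk
      ((continuous_boundaryMap Φ).comp (continuous_snd.comp continuous_subtype_val))) _

theorem measurable_doubleBoundaryMap [Finite S] (Φ : MulAut (FreeGroup S)) :
    Measurable (doubleBoundaryMap Φ) :=
  (continuous_doubleBoundaryMap Φ).measurable

theorem measurable_fst_end [Finite S] :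
    Measurable fun p : DoubleBoundary S => p.1.1 :=
  (continuous_fst.comp continuous_subtype_val).measurable

theorem measurable_snd_end [Finite S] :
    Measurable fun p : DoubleBoundary S => p.1.2 :=
  (continuous_snd.comp continuous_subtype_val).measurable

theorem exists_mem_cyl [Nonempty S] (v : FreeGroup S) : ∃ x : Boundary S, x ∈ cyl v := by
  have hred : FreeGroup.IsReduced v.toWord := FreeGroup.isReduced_toWord
  rw [FreeGroup.IsReduced, List.isChain_iff_getElem] at hred
  obtain ⟨b, hb⟩ : ∃ b : S × Bool, v.toWord ≠ [] → v.toWord.getLast? = some b := by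
    rcases List.eq_nil_or_concat v.toWord with h | ⟨L, b, h⟩
    · exact ⟨(Classical.arbitrary S, true), fun hne => absurd h hne⟩
    · exact ⟨b, fun _ => by simp [h]⟩
  -- The word is prolonged by repeating its last letter forever, which never cancels; for the empty
  -- word any letter will do.
  refine ⟨⟨fun i => v.toWord.getD i b, fun n => ?_⟩, fun i hi => ?_⟩
  · beta_reduce
    by_cases h1 : n + 1 < v.toWord.length
    · rw [List.getD_eq_getElem _ _ h1, List.getD_eq_getElem _ _ (by omega)]
      exact hred n h1
    · rw [List.getD_eq_default _ _ (by omega : v.toWord.length ≤ n + 1)]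
      by_cases h2 : n < v.toWord.length
      · have h3 := hb (by rintro h; simp [h] at h2)
        rw [List.getLast?_eq_getElem?, show v.toWord.length - 1 = n by omega,
          List.getElem?_eq_getElem h2] at h3
        rw [List.getD_eq_getElem _ _ h2, Option.some.inj h3]
        exact fun _ => rfl
      · rw [List.getD_eq_default _ _ (by omega)]
        exact fun _ => rfl
  · exact List.getD_eq_getElem _ _ hi

/-- Two measures on the double boundary that agree and are finite on small rectangles are
equal. -/
theorem measure_ext_of_rectFamily [Finite S] {η η' : Measure (DoubleBoundary S)} (N : ℕ)
    (hfin : ∀ E ∈ rectFamily S N, η E ≠ ⊤) (h : ∀ E ∈ rectFamily S N, η E = η' E) : η = η' := by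
  have hb := isTopologicalBasis_rectFamily (S := S) N
  have hsc := hb.secondCountableTopology (countable_rectFamily N)
  refine Measure.ext_of_generateFrom_of_cover_subset (hb.borel_eq_generateFrom)
    (isPiSystem_rectFamily N) subset_rfl (countable_rectFamily N) hb.sUnion_eq hfin h

end

section

variable {S : Type*} [DecidableEq S]

/-! ### The uniform probability measure on the boundary -/

section Uniform
variable [Fintype S]

/-- The number of letters that may follow a given letter in a reduced word. -/
def branching (S : Type*) [Fintype S] : ℕ := 2 * Fintype.card S - 1

/-- An enumeration of the letters that may follow the letter `b`. -/
noncomputable def nextLetter (b : S × Bool) :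
    Fin (branching S) ≃ {c : S × Bool // c ≠ (b.1, !b.2)} :=
  (Fintype.equivFinOfCardEq (by
    rw [Fintype.card_subtype_compl, Fintype.card_subtype_eq, Fintype.card_prod, Fintype.card_bool,
      branching, mul_comm])).symm

theorem eq_flip_of_ne {a c : S × Bool} (h : a.1 = c.1) (hne : a.2 ≠ c.2) : c = (a.1, !a.2) := by
  obtain ⟨a1, a2⟩ := a
  obtain ⟨c1, c2⟩ := c
  simp only at h hne
  subst h
  cases a2 <;> cases c2 <;> simp_all

/-- The letters of the ray described by a first letter and a sequence of choices. -/
noncomputable def rayLetters (w : Fin (Fintype.card (S × Bool)) × (ℕ → Fin (branching S))) :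
    ℕ → S × Bool
  | 0 => (Fintype.equivFin (S × Bool)).symm w.1
  | n + 1 => nextLetter (rayLetters w n) (w.2 n)

/-- The ray described by a first letter and a sequence of choices. -/
noncomputable def rayOf (w : Fin (Fintype.card (S × Bool)) × (ℕ → Fin (branching S))) :
    Boundary S :=
  ⟨rayLetters w, fun n h => by
    have h1 := (nextLetter (rayLetters w n) (w.2 n)).2
    change _ = (nextLetter (rayLetters w n) (w.2 n)).1.1 at h
    change _ = (nextLetter (rayLetters w n) (w.2 n)).1.2
    by_contra hne
    exact h1 (eq_flip_of_ne h hne)⟩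

theorem Boundary.letter_succ_ne (y : Boundary S) (n : ℕ) :
    y.letter (n + 1) ≠ ((y.letter n).1, !(y.letter n).2) := by
  intro h
  have h1 := y.2 n
  change (y.letter n).1 = (y.letter (n + 1)).1 → (y.letter n).2 = (y.letter (n + 1)).2 at h1
  rw [h] at h1
  simp at h1

/-- Knowing n + 1 letters amounts to knowing the first letter and the first n choices, so cylinders
pull back to boxes, whose product measure is explicit. -/
theorem rayOf_preimage_cyl_take (y : Boundary S) (n : ℕ) :
    rayOf ⁻¹' cyl (y.take (n + 1)) =
      {Fintype.equivFin _ (y.letter 0)} ×ˢ Set.pi (Finset.range n) fun i =>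
        {(nextLetter (y.letter i)).symm ⟨y.letter (i + 1), y.letter_succ_ne i⟩} := by
  ext w
  simp only [Set.mem_preimage, mem_cyl_take_iff, Set.mem_prod, Set.mem_singleton_iff,
    Set.mem_pi, Finset.coe_range, Set.mem_Iio]
  have h0 : (rayOf w).letter 0 = y.letter 0 ↔ w.1 = Fintype.equivFin _ (y.letter 0) :=
    Equiv.symm_apply_eq _
  have hs : ∀ i, (rayOf w).letter i = y.letter i →
      ((rayOf w).letter (i + 1) = y.letter (i + 1) ↔
        w.2 i = (nextLetter (y.letter i)).symm ⟨y.letter (i + 1), y.letter_succ_ne i⟩) := by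
    intro i hi
    rw [Equiv.eq_symm_apply, Subtype.ext_iff]
    simp only
    rw [← hi]
    rfl
  constructor
  · intro h
    exact ⟨h0.1 (h 0 (by omega)), fun i hi => (hs i (h i (by omega))).1 (h (i + 1) (by omega))⟩
  · rintro ⟨h1, h2⟩ i hi
    induction i with
    | zero => exact h0.2 h1
    | succ i ih => exact (hs i (ih (by omega))).2 (h2 i (by omega))

theorem measurable_rayOf : Measurable (rayOf (S := S)) := by
  have h : borel (Boundary S) = MeasurableSpace.generateFrom (Set.range (cyl (S := S))) :=
    isTopologicalBasis_cyl.borel_eq_generateFrom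
  change @Measurable _ _ _ (borel _) _
  rw [h]
  refine measurable_generateFrom ?_
  rintro _ ⟨v, rfl⟩
  rcases Nat.eq_zero_or_pos v.norm with h0 | hpos
  · rw [FreeGroup.norm_eq_zero.1 h0, cyl_one]
    exact MeasurableSet.univ
  by_cases hne : ∃ y, y ∈ cyl v
  · obtain ⟨y, hy⟩ := hne
    obtain ⟨n, hn⟩ := Nat.exists_eq_add_of_le' hpos
    rw [← mem_cyl_iff_take.1 hy, hn, rayOf_preimage_cyl_take]
    exact (measurableSet_singleton _).prod
      (MeasurableSet.pi (Finset.countable_toSet _) fun i _ => measurableSet_singleton _)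
  · rw [Set.eq_empty_of_forall_notMem fun y hy => hne ⟨y, hy⟩]
    exact MeasurableSet.empty

variable [Nonempty S]

theorem branching_pos : 0 < branching S := by
  have := Fintype.card_pos (α := S)
  rw [branching]; omega

theorem cast_branching : ((branching S : ℕ) : ℝ) = 2 * Fintype.card S - 1 := by
  have := Fintype.card_pos (α := S)
  rw [branching, Nat.cast_sub (by omega)]
  push_cast; ring

instance : NeZero (branching S) := ⟨branching_pos.ne'⟩

instance : NeZero (Fintype.card (S × Bool)) := ⟨Fintype.card_ne_zero⟩

/-- The uniform probability measure on the boundary. -/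
noncomputable def uniformMeasure (S : Type*) [DecidableEq S] [Fintype S] [Nonempty S] :
    Measure (Boundary S) :=
  ((PMF.uniformOfFintype (Fin (Fintype.card (S × Bool)))).toMeasure.prod
    (Measure.infinitePi fun _ : ℕ => (PMF.uniformOfFintype (Fin (branching S))).toMeasure)).map
      rayOf

instance : IsProbabilityMeasure (uniformMeasure S) :=
  Measure.isProbabilityMeasure_map measurable_rayOf.aemeasurable

theorem uniformMeasure_cyl_take (y : Boundary S) (n : ℕ) :
    uniformMeasure S (cyl (y.take (n + 1))) =
      (2 * Fintype.card S : ENNReal)⁻¹ * (branching S : ENNReal)⁻¹ ^ n := by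
  rw [uniformMeasure, Measure.map_apply measurable_rayOf (measurableSet_cyl _),
    rayOf_preimage_cyl_take, Measure.prod_prod,
    Measure.infinitePi_pi _ fun i _ => measurableSet_singleton _]
  simp [PMF.uniformOfFintype_apply, mul_comm]

theorem uniformMeasure_cyl {v : FreeGroup S} (hv : v ≠ 1) :
    (uniformMeasure S).real (cyl v) =
      1 / ((branching S + 1) * (branching S : ℝ) ^ (v.norm - 1)) := by
  obtain ⟨y, hy⟩ := exists_mem_cyl v
  obtain ⟨n, hn⟩ := Nat.exists_eq_add_of_le'
    (Nat.pos_of_ne_zero fun h => hv (FreeGroup.norm_eq_zero.1 h))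
  have h1 := uniformMeasure_cyl_take y n
  rw [← hn, mem_cyl_iff_take.1 hy] at h1
  rw [Measure.real, h1, cast_branching, hn]
  simp [cast_branching, mul_comm]

theorem uniformMeasure_letter (a : S × Bool) :
    (uniformMeasure S).real {x | x.letter 0 = a} = 1 / (branching S + 1) := by
  have h : {x : Boundary S | x.letter 0 = a} = cyl (letterElt a) := by
    ext x; exact mem_cyl_letterElt.symm
  rw [h, uniformMeasure_cyl]
  · simp
  · rw [ne_eq, ← FreeGroup.norm_eq_zero]; simp

end Uniform

end

section

variable {S : Type*} [DecidableEq S]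

/-! ### Geodesics through a segment -/

theorem toWord_mul_of_norm {g h : FreeGroup S} (H : (g * h).norm = g.norm + h.norm) :
    (g * h).toWord = g.toWord ++ h.toWord :=
  (FreeGroup.toWord_mul_sublist g h).eq_of_length (by
    rw [List.length_append]; exact H)

theorem ConvergesTo.comp_tendsto {u : ℕ → FreeGroup S} {x : Boundary S} (h : ConvergesTo u x)
    {φ : ℕ → ℕ} (hφ : Tendsto φ atTop atTop) : ConvergesTo (u ∘ φ) x := fun m =>
  hφ.eventually (h m)

/-- The limit of a geodesic ray issuing from `1` lies in the cylinders of its vertices. -/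
theorem ConvergesTo.mem_cyl_of_geodesic {z : ℕ → FreeGroup S} {x : Boundary S}
    (h : ConvergesTo z x) (h0 : z 0 = 1)
    (hz : ∀ n m, n ≤ m → ((z n)⁻¹ * z m).norm = m - n) (n : ℕ) : x ∈ cyl (z n) := by
  have hnorm : ∀ m, (z m).norm = m := fun m => by simpa [h0] using hz 0 m (Nat.zero_le m)
  refine mem_cyl_iff_getElem?.2 fun i hi => ?_
  obtain ⟨m, h1, h2⟩ := ((h i).and (eventually_ge_atTop n)).exists
  have h3 : (z n * ((z n)⁻¹ * z m)).toWord = (z n).toWord ++ ((z n)⁻¹ * z m).toWord := by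
    refine toWord_mul_of_norm ?_
    rw [mul_inv_cancel_left, hz n m h2, hnorm, hnorm]
    omega
  rw [mul_inv_cancel_left] at h3
  rw [h3, List.getElem?_append_left hi] at h1
  exact h1

theorem Boundary.norm_inv_take_mul_take (x : Boundary S) (a b : ℕ) :
    ((x.take a)⁻¹ * x.take b).norm = ((b : ℤ) - a).natAbs := by
  have key : ∀ a n : ℕ, ((x.take a)⁻¹ * x.take (a + n)).norm = n := by
    intro a n
    have h : x.take (a + n) = x.take a * (x.drop a).take n := by
      rw [take, take, take, FreeGroup.mul_mk, List.range_add, List.map_append, List.map_map]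
      rfl
    rw [h, inv_mul_cancel_left, norm_take]
  rcases le_total a b with h | h
  · obtain ⟨n, rfl⟩ := Nat.exists_eq_add_of_le h
    rw [key]
    omega
  · obtain ⟨n, rfl⟩ := Nat.exists_eq_add_of_le h
    rw [← FreeGroup.norm_inv_eq, mul_inv_rev, inv_inv, key]
    omega

theorem Boundary.head?_take_succ (x : Boundary S) (n : ℕ) :
    (x.take (n + 1)).toWord.head? = some (x.letter 0) := by
  rw [List.head?_eq_getElem?, x.getElem?_toWord_take (Nat.succ_pos n)]

theorem norm_inv_take_mul_take_of_ne {x y : Boundary S} (h : x.letter 0 ≠ y.letter 0)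
    (a b : ℕ) : ((x.take a)⁻¹ * y.take b).norm = a + b := by
  rcases a with _ | a
  · have : x.take 0 = 1 := rfl
    rw [this, inv_one, one_mul, y.norm_take, Nat.zero_add]
  rcases b with _ | b
  · have : y.take 0 = 1 := rfl
    rw [this, mul_one, FreeGroup.norm_inv_eq, x.norm_take]
  have : ((x.take (a + 1))⁻¹ * y.take (b + 1)).toWord =
      (x.take (a + 1))⁻¹.toWord ++ (y.take (b + 1)).toWord := by
    refine toWord_mul_of_head? fun c hc => ?_
    rw [Boundary.head?_take_succ] at hc
    rw [inv_inv, Boundary.head?_take_succ, ← Option.some.inj hc]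
    exact fun h' => h (Option.some.inj h')
  rw [FreeGroup.norm, this, List.length_append, ← FreeGroup.norm, ← FreeGroup.norm,
    FreeGroup.norm_inv_eq, x.norm_take, y.norm_take]

/-- The bi-infinite path through `1` formed by two rays. -/
def joinRays (x y : Boundary S) : ℤ → FreeGroup S
  | Int.ofNat n => y.take n
  | Int.negSucc n => x.take (n + 1)

theorem joinRays_natCast (x y : Boundary S) (n : ℕ) : joinRays x y n = y.take n := rfl

theorem joinRays_neg_natCast (x y : Boundary S) (n : ℕ) : joinRays x y (-n) = x.take n := by
  rcases n with _ | n
  · rfl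
  · rfl

theorem norm_inv_joinRays_mul_joinRays {x y : Boundary S} (h : x.letter 0 ≠ y.letter 0)
    (i j : ℤ) : ((joinRays x y i)⁻¹ * joinRays x y j).norm = (j - i).natAbs := by
  obtain ⟨a, rfl | rfl⟩ := i.eq_nat_or_neg <;> obtain ⟨b, rfl | rfl⟩ := j.eq_nat_or_neg <;>
    simp only [joinRays_natCast, joinRays_neg_natCast]
  · exact y.norm_inv_take_mul_take a b
  · rw [norm_inv_take_mul_take_of_ne h.symm]; omega
  · rw [norm_inv_take_mul_take_of_ne h]; omega
  · rw [x.norm_inv_take_mul_take]; omega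

section
variable [Finite S]

theorem mem_segmentCyl_of_letter_ne {p : DoubleBoundary S} {x : FreeGroup S}
    (h : (translate x⁻¹ p.1.1).letter 0 ≠ (translate x⁻¹ p.1.2).letter 0) (n : ℕ) :
    p ∈ segmentCyl x (x * (translate x⁻¹ p.1.2).take n) := by
  refine ⟨fun i => x * joinRays (translate x⁻¹ p.1.1) (translate x⁻¹ p.1.2) i, ⟨fun i j => ?_,
    ?_, ?_⟩, 0, n, Int.natCast_nonneg n, mul_one x, rfl⟩
  · rw [mul_inv_rev, mul_assoc, inv_mul_cancel_left, norm_inv_joinRays_mul_joinRays h]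
  · have := (Boundary.convergesTo_take (translate x⁻¹ p.1.1)).mul_left x
    simpa only [joinRays_neg_natCast, translate_translate_inv] using this
  · have := (Boundary.convergesTo_take (translate x⁻¹ p.1.2)).mul_left x
    simpa only [joinRays_natCast, translate_translate_inv] using this

theorem IsGeodesic.snd_mem_cyl {γ : ℤ → FreeGroup S} {p : DoubleBoundary S}
    (h : IsGeodesic γ p) {i j : ℤ} (hij : i ≤ j) :
    translate (γ i)⁻¹ p.1.2 ∈ cyl ((γ i)⁻¹ * γ j) := by
  obtain ⟨n, rfl⟩ := Int.le.dest hij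
  have htend : Tendsto (fun n : ℕ => (i + n).toNat) atTop atTop :=
    tendsto_atTop_atTop.2 fun b => ⟨b + i.natAbs, fun a ha => by omega⟩
  have hconv : ConvergesTo (fun n : ℕ => (γ i)⁻¹ * γ (i + n)) (translate (γ i)⁻¹ p.1.2) := by
    intro m
    filter_upwards [(h.2.2.comp_tendsto htend).mul_left (γ i)⁻¹ m,
      eventually_ge_atTop i.natAbs] with n hn hi
    have h1 : (((i + n).toNat : ℕ) : ℤ) = i + n := by omega
    simpa only [Function.comp_apply, h1] using hn
  refine hconv.mem_cyl_of_geodesic (by simp) (fun a b hab => ?_) n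
  rw [mul_inv_rev, inv_inv, mul_assoc, mul_inv_cancel_left, h.1]
  omega

theorem IsGeodesic.fst_mem_cyl {γ : ℤ → FreeGroup S} {p : DoubleBoundary S}
    (h : IsGeodesic γ p) {i j : ℤ} (hij : i ≤ j) :
    translate (γ j)⁻¹ p.1.1 ∈ cyl ((γ j)⁻¹ * γ i) := by
  have h' : IsGeodesic (fun k => γ (-k)) ⟨(p.1.2, p.1.1), p.2.symm⟩ :=
    ⟨fun i j => by rw [h.1]; omega, by simpa only [neg_neg] using h.2.2, h.2.1⟩
  simpa only [neg_neg] using h'.snd_mem_cyl (i := -j) (j := -i) (by omega)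

theorem head?_eq_of_mem_cyl {w : FreeGroup S} (hw : w ≠ 1) {x : Boundary S} (h : x ∈ cyl w) :
    w.toWord.head? = some (x.letter 0) := by
  rw [List.head?_eq_getElem?]
  exact mem_cyl_iff_getElem?.1 h 0
    (Nat.pos_of_ne_zero fun h => hw (FreeGroup.norm_eq_zero.1 h))

/-- Each end, seen from the opposite endpoint of the segment, must begin by running along the
segment. Conversely, these conditions make the two ends leave x by different letters, so the two
rays from x join to a geodesic, which reaches y after |x⁻¹y| steps. -/
theorem mem_segmentCyl_iff {x y : FreeGroup S} (hxy : x ≠ y) {p : DoubleBoundary S} :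
    p ∈ segmentCyl x y ↔
      translate x⁻¹ p.1.2 ∈ cyl (x⁻¹ * y) ∧ translate y⁻¹ p.1.1 ∈ cyl (y⁻¹ * x) := by
  constructor
  · rintro ⟨γ, hγ, i, j, hij, rfl, rfl⟩
    exact ⟨hγ.snd_mem_cyl hij, hγ.fst_mem_cyl hij⟩
  · rintro ⟨h1, h2⟩
    have h3 : (translate x⁻¹ p.1.1).letter 0 ≠ (translate x⁻¹ p.1.2).letter 0 := by
      have h4 : translate y⁻¹ p.1.1 = translate (y⁻¹ * x) (translate x⁻¹ p.1.1) := by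
        rw [← translate_mul, mul_assoc, mul_inv_cancel, mul_one]
      rw [h4, translate_mem_cyl_self_iff, mul_inv_rev, inv_inv,
        head?_eq_of_mem_cyl (by rwa [ne_eq, inv_mul_eq_one]) h1] at h2
      exact fun h => h2 (by rw [h])
    have h5 := mem_segmentCyl_of_letter_ne h3 (x⁻¹ * y).norm
    rwa [mem_cyl_iff_take.1 h1, mul_inv_cancel_left] at h5

/-- Both conditions are now read from x, so that after one translation the set becomes a product. -/
theorem mem_segmentCyl_iff_letter {x y : FreeGroup S} (hxy : x ≠ y) {p : DoubleBoundary S} :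
    p ∈ segmentCyl x y ↔ (x⁻¹ * y).toWord.head? ≠ some ((translate x⁻¹ p.1.1).letter 0) ∧
      translate x⁻¹ p.1.2 ∈ cyl (x⁻¹ * y) := by
  have h4 : translate y⁻¹ p.1.1 = translate (y⁻¹ * x) (translate x⁻¹ p.1.1) := by
    rw [← translate_mul, mul_assoc, mul_inv_cancel, mul_one]
  rw [mem_segmentCyl_iff hxy, h4, translate_mem_cyl_self_iff, mul_inv_rev, inv_inv, and_comm]

theorem mem_baseBall_iff {p : DoubleBoundary S} :
    p ∈ baseBall S ↔ p.1.1.letter 0 ≠ p.1.2.letter 0 := by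
  constructor
  · rintro ⟨γ, hγ, i, j, hij, h1, h2⟩
    have h3 := hγ.snd_mem_cyl (i := i) (j := i + 1) (by omega)
    have h4 := hγ.fst_mem_cyl (i := i - 1) (j := i) (by omega)
    have h5 := hγ.1 (i - 1) (i + 1)
    have h6 := hγ.1 i (i - 1)
    have h7 := hγ.1 i (i + 1)
    simp only [h1, inv_one, translate_one, one_mul] at h3 h4 h6 h7
    have h8 : ((i - 1) - i).natAbs = 1 := by omega
    have h9 : ((i + 1) - i).natAbs = 1 := by omega
    rw [mem_cyl_iff_take] at h3 h4
    rw [h6, h8] at h4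
    rw [h7, h9] at h3
    intro he
    rw [← h3, ← h4, (Boundary.take_eq_take_iff (x := p.1.1) (y := p.1.2) (n := 1)).2
      (by simpa using he)] at h5
    simp at h5
  · intro h
    rw [baseBall]
    simpa [translate_one, Boundary.take, ← FreeGroup.one_eq_mk] using
      mem_segmentCyl_of_letter_ne (p := p) (x := 1) (by simpa [translate_one] using h) 0

end

/-! ### Disjoint cylinders -/

/-- Exactly the common prefix of length n cancels: the letters after it differ. -/
theorem toWord_inv_mul_of_apexAt {u v : FreeGroup S} {x y : Boundary S} {n : ℕ}
    (hx : x ∈ cyl u) (hy : y ∈ cyl v) (hu : n < u.norm) (hv : n < v.norm)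
    (h : (x, y) ∈ apexAt S n) :
    (u⁻¹ * v).toWord = FreeGroup.invRev (u.toWord.drop n) ++ v.toWord.drop n := by
  rw [mem_cyl_iff_getElem?] at hx hy
  have hdrop : ∀ (w : FreeGroup S) (z : Boundary S), n < w.norm →
      (∀ i < w.norm, w.toWord[i]? = some (z.letter i)) →
      w = z.take n * FreeGroup.mk (w.toWord.drop n) ∧
      (FreeGroup.mk (w.toWord.drop n)).toWord = w.toWord.drop n ∧
      (w.toWord.drop n).head? = some (z.letter n) := by
    intro w z hn hz
    refine ⟨?_, ?_, ?_⟩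
    · rw [← initSeg_eq_take (g := w) fun i hi => hz i (by omega), initSeg, FreeGroup.mul_mk,
        List.take_append_drop, FreeGroup.mk_toWord]
    · exact toWord_mk_of_isReduced
        (FreeGroup.isReduced_toWord.infix (List.drop_suffix n _).isInfix)
    · rw [List.head?_drop, hz n hn]
  obtain ⟨hu1, hu2, hu3⟩ := hdrop u x hu hx
  obtain ⟨hv1, hv2, hv3⟩ := hdrop v y hv hy
  have hc : x.take n = y.take n := Boundary.take_eq_take_iff.2 h.1
  have : u⁻¹ * v = (FreeGroup.mk (u.toWord.drop n))⁻¹ * FreeGroup.mk (v.toWord.drop n) := by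
    conv_lhs => rw [hu1, hv1, hc]
    group
  rw [this, toWord_mul_of_head?, FreeGroup.toWord_inv, hu2, hv2]
  intro b hb
  rw [hv2, hv3] at hb
  rw [inv_inv, hu2, hu3, ← Option.some.inj hb]
  exact fun h' => h.2 (Option.some.inj h')

/-- If two rays of the cylinders agreed up to the end of u or of v, one of them would lie in both
cylinders. So the branching happens strictly inside both words and is the same for all pairs. -/
theorem exists_apexAt_of_disjoint_cyl [Nonempty S] {u v : FreeGroup S}
    (h : Disjoint (cyl u) (cyl v)) :
    ∃ n, n < u.norm ∧ n < v.norm ∧ cyl u ×ˢ cyl v ⊆ apexAt S n := by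
  obtain ⟨x, hx⟩ := exists_mem_cyl u
  obtain ⟨y, hy⟩ := exists_mem_cyl v
  rw [Set.disjoint_left] at h
  have hxy : x ≠ y := fun he => h hx (he ▸ hy)
  obtain ⟨n, hn⟩ := exists_mem_apexAt (p := (x, y)) hxy
  have hu : n < u.norm := by
    by_contra! hlt
    refine h (a := y) ?_ hy
    rw [mem_cyl_iff_getElem?] at hx ⊢
    intro i hi
    rw [hx i hi, hn.1 i (by omega)]
  have hv : n < v.norm := by
    by_contra! hlt
    refine h (a := x) hx ?_
    rw [mem_cyl_iff_getElem?] at hy ⊢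
    intro i hi
    rw [hy i hi, hn.1 i (by omega)]
  refine ⟨n, hu, hv, ?_⟩
  rintro ⟨x', y'⟩ ⟨hx', hy'⟩
  rw [mem_cyl_iff_getElem?] at hx hy hx' hy'
  have hxx : ∀ i < u.norm, x'.letter i = x.letter i := fun i hi =>
    Option.some.inj ((hx' i hi).symm.trans (hx i hi))
  have hyy : ∀ i < v.norm, y'.letter i = y.letter i := fun i hi =>
    Option.some.inj ((hy' i hi).symm.trans (hy i hi))
  refine ⟨fun i hi => ?_, ?_⟩
  · rw [hxx i (by omega), hyy i (by omega)]; exact hn.1 i hi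
  · simp only
    rw [hxx n hu, hyy n hv]; exact hn.2

theorem norm_inv_mul_of_apexAt [Nonempty S] {u v : FreeGroup S} {n : ℕ} (hu : n < u.norm)
    (hv : n < v.norm) (h : cyl u ×ˢ cyl v ⊆ apexAt S n) :
    (u⁻¹ * v).norm + 2 * n = u.norm + v.norm := by
  obtain ⟨x, hx⟩ := exists_mem_cyl u
  obtain ⟨y, hy⟩ := exists_mem_cyl v
  have := toWord_inv_mul_of_apexAt hx hy hu hv (h ⟨hx, hy⟩)
  rw [FreeGroup.norm] at hu hv ⊢
  rw [this, List.length_append, FreeGroup.invRev_length, List.length_drop, List.length_drop,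
    FreeGroup.norm, FreeGroup.norm]
  omega

theorem head?_toWord_inv_mul_of_disjoint_cyl [Nonempty S] {u v : FreeGroup S}
    (h : Disjoint (cyl u) (cyl v)) : (u⁻¹ * v).toWord.head? = u⁻¹.toWord.head? := by
  obtain ⟨n, hu, hv, hsub⟩ := exists_apexAt_of_disjoint_cyl h
  obtain ⟨x, hx⟩ := exists_mem_cyl u
  obtain ⟨y, hy⟩ := exists_mem_cyl v
  have hne : FreeGroup.invRev (u.toWord.drop n) ≠ [] := by
    rw [ne_eq, ← List.length_eq_zero_iff, FreeGroup.invRev_length, List.length_drop]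
    rw [FreeGroup.norm] at hu
    omega
  rw [toWord_inv_mul_of_apexAt hx hy hu hv (hsub ⟨hx, hy⟩), FreeGroup.toWord_inv,
    List.head?_append_of_ne_nil _ hne]
  conv_rhs => rw [← List.take_append_drop n u.toWord, FreeGroup.invRev_append]
  rw [List.head?_append_of_ne_nil _ hne]

/-- Since u and v branch, the path from u to v starts by retracing a nonempty end of u, and
symmetrically at v. Being beyond u as seen from v is therefore lying in the cylinder of u. This
turns the prescribed masses of segments into masses of a generating π-system. -/
theorem segmentCyl_eq_rect [Finite S] [Nonempty S] {u v : FreeGroup S}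
    (h : Disjoint (cyl u) (cyl v)) : segmentCyl u v = rect u v := by
  have huv : u ≠ v := by
    rintro rfl
    obtain ⟨x, hx⟩ := exists_mem_cyl u
    exact Set.disjoint_left.1 h hx hx
  ext p
  rw [mem_segmentCyl_iff huv, translate_mem_cyl_mul_iff, translate_mem_cyl_mul_iff, and_comm]
  · rfl
  · rw [mul_inv_rev, inv_inv, head?_toWord_inv_mul_of_disjoint_cyl h]
  · rw [mul_inv_rev, inv_inv, head?_toWord_inv_mul_of_disjoint_cyl h.symm]

end

section

variable {S : Type*} [DecidableEq S] [Fintype S] [Nonempty S]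

/-! ### The uniform current -/

theorem cast_branching_pos : (0 : ℝ) < branching S := by exact_mod_cast branching_pos (S := S)

/-- The uniform current: on the pairs of rays with longest common initial segment of length `n`,
it is a multiple of the product of the uniform measures. -/
noncomputable def uniformCurrent (S : Type*) [DecidableEq S] [Fintype S] [Nonempty S] :
    Measure (DoubleBoundary S) :=
  (Measure.sum fun n : ℕ =>
    ENNReal.ofReal ((branching S + 1) / branching S * (branching S : ℝ) ^ (2 * n)) •
      ((uniformMeasure S).prod (uniformMeasure S)).restrict (apexAt S n)).comap Subtype.val

theorem uniformCurrent_apply_of_subset {E : Set (Boundary S × Boundary S)}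
    (hE : MeasurableSet E) {n : ℕ} (h : E ⊆ apexAt S n) :
    uniformCurrent S (Subtype.val ⁻¹' E) =
      ENNReal.ofReal ((branching S + 1) / branching S * (branching S : ℝ) ^ (2 * n)) *
        ((uniformMeasure S).prod (uniformMeasure S)) E := by
  have himg : (Subtype.val : DoubleBoundary S → _) '' (Subtype.val ⁻¹' E) = E := by
    rw [Set.image_preimage_eq_iff]
    exact fun p hp => ⟨⟨p, ne_of_mem_apexAt (h hp)⟩, rfl⟩
  rw [uniformCurrent, measurableEmbedding_val.comap_apply, himg, Measure.sum_apply _ hE,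
    tsum_eq_single n]
  · rw [Measure.smul_apply, Measure.restrict_apply hE, Set.inter_eq_left.2 h, smul_eq_mul]
  · intro m hm
    rw [Measure.smul_apply, Measure.restrict_apply hE,
      ((disjoint_apexAt hm.symm).mono_left h).inter_eq, measure_empty, smul_zero]

theorem uniformCurrent_prod {A B : Set (Boundary S)} (hA : MeasurableSet A)
    (hB : MeasurableSet B) {n : ℕ} (h : A ×ˢ B ⊆ apexAt S n) :
    uniformCurrent S {p | p.1.1 ∈ A ∧ p.1.2 ∈ B} =
      ENNReal.ofReal ((branching S + 1) / branching S * (branching S : ℝ) ^ (2 * n) *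
        ((uniformMeasure S).real A * (uniformMeasure S).real B)) := by
  have h1 := uniformCurrent_apply_of_subset (hA.prod hB) h
  have hq := cast_branching_pos (S := S)
  rw [ENNReal.ofReal_mul (q := (uniformMeasure S).real A * _) (by positivity),
    ENNReal.ofReal_mul (q := (uniformMeasure S).real B) measureReal_nonneg,
    ofReal_measureReal, ofReal_measureReal, ← Measure.prod_prod, ← h1]
  rfl

/-- If the words branch at depth n, then |u⁻¹v| = |u| + |v| - 2n, and the weight q^(2n) compensates
for the common prefix being counted in both cylinder measures. -/
theorem uniformCurrent_rect {u v : FreeGroup S} (h : Disjoint (cyl u) (cyl v)) :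
    uniformCurrent S (rect u v) =
      ENNReal.ofReal (1 / ((branching S + 1) * (branching S : ℝ) ^ ((u⁻¹ * v).norm - 1))) := by
  obtain ⟨n, hu, hv, hsub⟩ := exists_apexAt_of_disjoint_cyl h
  have hq := cast_branching_pos (S := S)
  have hne : ∀ w : FreeGroup S, n < w.norm → w ≠ 1 := by
    rintro w hw rfl
    simp at hw
  have hnorm := norm_inv_mul_of_apexAt hu hv hsub
  rw [rect, uniformCurrent_prod (measurableSet_cyl u) (measurableSet_cyl v) hsub,
    uniformMeasure_cyl (hne u hu), uniformMeasure_cyl (hne v hv)]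
  congr 1
  obtain ⟨a, ha⟩ := Nat.exists_eq_add_of_lt hu
  obtain ⟨b, hb⟩ := Nat.exists_eq_add_of_lt hv
  rw [show (u⁻¹ * v).norm - 1 = a + b + 1 by omega, show u.norm - 1 = n + a by omega,
    show v.norm - 1 = n + b by omega]
  field_simp
  ring

theorem doubleBoundaryMap_conj_fst (g : FreeGroup S) (p : DoubleBoundary S) :
    (doubleBoundaryMap (MulAut.conj g) p).1.1 = translate g p.1.1 := rfl

theorem doubleBoundaryMap_conj_snd (g : FreeGroup S) (p : DoubleBoundary S) :
    (doubleBoundaryMap (MulAut.conj g) p).1.2 = translate g p.1.2 := rfl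

/-- The inverse of g is too short to cancel u completely, so the last letter of u survives in g⁻¹u.
-/
theorem translate_mem_cyl_iff_of_norm_lt {g u : FreeGroup S} (h : g.norm < u.norm)
    {x : Boundary S} : translate g x ∈ cyl u ↔ x ∈ cyl (g⁻¹ * u) := by
  have h1 : (g * (g⁻¹ * u))⁻¹.toWord.head? = (g⁻¹ * u)⁻¹.toWord.head? := by
    rw [mul_inv_cancel_left, mul_inv_rev, inv_inv, List.head?_eq_getElem?,
      List.head?_eq_getElem?]
    conv_rhs => rw [← FreeGroup.mk_toWord (x := g)]
    refine (getElem?_toWord_mul_mk _ _ ?_).symm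
    rw [FreeGroup.norm_inv_eq, Nat.zero_add]
    exact h
  have := translate_mem_cyl_mul_iff (x := x) h1
  rwa [mul_inv_cancel_left] at this

/-- It is enough to test rectangles whose words are longer than g. These pull back to rectangles of
g⁻¹u and g⁻¹v, and (g⁻¹u)⁻¹(g⁻¹v) = u⁻¹v. -/
theorem uniformCurrent_map_conj (g : FreeGroup S) :
    (uniformCurrent S).map (doubleBoundaryMap (MulAut.conj g)) = uniformCurrent S := by
  refine (measure_ext_of_rectFamily (g.norm + 1) ?_ ?_).symm
  · rintro _ ⟨u, v, hu, hv, hd, rfl⟩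
    rw [uniformCurrent_rect hd]
    exact ENNReal.ofReal_ne_top
  · rintro _ ⟨u, v, hu, hv, hd, rfl⟩
    rw [Measure.map_apply (measurable_doubleBoundaryMap _) (isOpen_rect u v).measurableSet]
    have h1 : doubleBoundaryMap (MulAut.conj g) ⁻¹' rect u v = rect (g⁻¹ * u) (g⁻¹ * v) := by
      ext p
      exact and_congr (translate_mem_cyl_iff_of_norm_lt (by omega))
        (translate_mem_cyl_iff_of_norm_lt (by omega))
    have h2 : Disjoint (cyl (g⁻¹ * u)) (cyl (g⁻¹ * v)) := by
      rw [Set.disjoint_left] at hd ⊢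
      intro x hx hx'
      exact hd ((translate_mem_cyl_iff_of_norm_lt (by omega)).2 hx)
        ((translate_mem_cyl_iff_of_norm_lt (by omega)).2 hx')
    rw [h1, uniformCurrent_rect hd, uniformCurrent_rect h2, mul_inv_rev, inv_inv, mul_assoc,
      mul_inv_cancel_left]

theorem uniformCurrent_preimage_conj (g : FreeGroup S) {E : Set (DoubleBoundary S)}
    (hE : MeasurableSet E) :
    uniformCurrent S (doubleBoundaryMap (MulAut.conj g) ⁻¹' E) = uniformCurrent S E := by
  rw [← Measure.map_apply (measurable_doubleBoundaryMap _) hE, uniformCurrent_map_conj]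

theorem isCurrent_uniformCurrent : IsCurrent (uniformCurrent S) where
  finite_on_compact := by
    have : IsLocallyFiniteMeasure (uniformCurrent S) := by
      refine ⟨fun p => ?_⟩
      obtain ⟨m, hm⟩ := exists_mem_apexAt p.2
      refine ⟨rect (p.1.1.take (m + 1)) (p.1.2.take (m + 1)), (isOpen_rect _ _).mem_nhds
        ⟨Boundary.mem_cyl_take _ _, Boundary.mem_cyl_take _ _⟩, ?_⟩
      rw [uniformCurrent_rect (disjoint_cyl_take hm (by omega))]
      exact ENNReal.ofReal_lt_top
    infer_instance
  invariant := uniformCurrent_map_conj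

theorem measurableSet_head?_ne (o : Option (S × Bool)) :
    MeasurableSet {x : Boundary S | o ≠ some (x.letter 0)} := by
  rcases o with _ | a
  · simp
  · simpa [Set.compl_def, eq_comm] using (measurableSet_letter 0 a).compl

theorem uniformMeasure_letter_ne (a : S × Bool) :
    (uniformMeasure S).real {x | some a ≠ some (x.letter 0)} =
      branching S / (branching S + 1) := by
  have h : {x : Boundary S | some a ≠ some (x.letter 0)} = {x | x.letter 0 = a}ᶜ := by
    ext x; simp [eq_comm]
  have hq := cast_branching_pos (S := S)
  rw [h, probReal_compl_eq_one_sub (measurableSet_letter 0 a), uniformMeasure_letter]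
  field_simp
  ring

/-- Seen from x, the second end lies in the cylinder of w = x⁻¹y and the first avoids one letter.
The latter has probability q/(q+1), which cancels the factor (q+1)/q of the current at depth 0. -/
theorem uniformCurrent_segmentCyl {x y : FreeGroup S} (hxy : x ≠ y) :
    uniformCurrent S (segmentCyl x y) =
      ENNReal.ofReal (1 / ((branching S + 1) * (branching S : ℝ) ^ ((x⁻¹ * y).norm - 1))) := by
  set w := x⁻¹ * y with hw
  have hw1 : w ≠ 1 := by rwa [hw, ne_eq, inv_mul_eq_one]
  obtain ⟨a, ha⟩ : ∃ a, w.toWord.head? = some a := by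
    obtain ⟨z, hz⟩ := exists_mem_cyl w
    exact ⟨_, head?_eq_of_mem_cyl hw1 hz⟩
  set A : Set (Boundary S) := {z | some a ≠ some (z.letter 0)} with hA
  have hAm : MeasurableSet A := measurableSet_head?_ne _
  have h1 : segmentCyl x y =
      doubleBoundaryMap (MulAut.conj x⁻¹) ⁻¹' {p | p.1.1 ∈ A ∧ p.1.2 ∈ cyl w} := by
    ext p
    rw [mem_segmentCyl_iff_letter hxy, ← hw, ha]
    rfl
  have hsub : A ×ˢ cyl w ⊆ apexAt S 0 := by
    rintro ⟨z, z'⟩ ⟨hz, hz'⟩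
    refine ⟨fun i hi => absurd hi (by omega), fun he => hz ?_⟩
    rw [← ha, head?_eq_of_mem_cyl hw1 hz', he]
  have hq := cast_branching_pos (S := S)
  rw [h1, uniformCurrent_preimage_conj, uniformCurrent_prod hAm (measurableSet_cyl w) hsub, hA,
    uniformMeasure_letter_ne, uniformMeasure_cyl hw1]
  · congr 1
    field_simp
    simp
  · exact (measurable_fst_end hAm).inter (measurable_snd_end (measurableSet_cyl w))

theorem isUniformCurrent_uniformCurrent : IsUniformCurrent (uniformCurrent S) where
  isCurrent := isCurrent_uniformCurrent
  segmentCyl_eq x y hxy := by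
    rw [uniformCurrent_segmentCyl hxy, cast_branching, sub_add_cancel]

theorem IsUniformCurrent.eq_uniformCurrent {η : Measure (DoubleBoundary S)}
    (h : IsUniformCurrent η) : η = uniformCurrent S := by
  have key : ∀ E ∈ rectFamily S 0, uniformCurrent S E = η E := by
    rintro _ ⟨u, v, hu, hv, hd, rfl⟩
    have huv : u ≠ v := by
      rintro rfl
      obtain ⟨x, hx⟩ := exists_mem_cyl u
      exact Set.disjoint_left.1 hd hx hx
    rw [← segmentCyl_eq_rect hd, h.segmentCyl_eq u v huv,
      isUniformCurrent_uniformCurrent.segmentCyl_eq u v huv]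
  refine (measure_ext_of_rectFamily 0 ?_ key).symm
  rintro _ ⟨u, v, hu, hv, hd, rfl⟩
  rw [uniformCurrent_rect hd]
  exact ENNReal.ofReal_ne_top

end

section

variable {S : Type*} [DecidableEq S] [Fintype S] [Nonempty S]

/-! ### Harmonic measures along an edge -/

/-- Translation by a letter `a` scales the uniform measure by a constant on the rays that do not
start with `a⁻¹`. -/
theorem uniformMeasure_preimage_translate_letter (a : S × Bool) {X : Set (Boundary S)}
    (hX : MeasurableSet X) (hXa : X ⊆ {x | x.letter 0 = a}) :
    (uniformMeasure S).real (translate (letterElt a) ⁻¹' X) =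
      branching S * (uniformMeasure S).real X := by
  have hq := cast_branching_pos (S := S)
  have hflip : (a.1, !a.2) ≠ a := by
    intro h
    have := congrArg Prod.snd h
    simp at this
  have haa : (letterElt a * letterElt a).toWord = [a, a] := by
    rw [toWord_mul_of_head?]
    · simp
    · intro b hb
      rw [letterElt_inv]
      simp only [toWord_letterElt, List.head?_cons, Option.mem_some_iff, ne_eq,
        Option.some.injEq] at hb ⊢
      exact hb ▸ hflip
  -- Invariance of the current is applied to B × X. Its preimage under translation by a is B' ×
  -- a⁻¹X; both are at depth 0, where the current is a multiple of μ × μ, and μ(B) = q μ(B').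
  set B := cyl (letterElt a)⁻¹ with hB
  set B' := cyl ((letterElt a)⁻¹ * (letterElt a)⁻¹) with hB'
  have hne : (letterElt a)⁻¹ ≠ 1 := by
    rw [ne_eq, inv_eq_one, ← FreeGroup.norm_eq_zero, norm_letterElt]; exact one_ne_zero
  have hnorm : ((letterElt a)⁻¹ * (letterElt a)⁻¹).norm = 2 := by
    rw [← FreeGroup.norm_inv_eq, mul_inv_rev, inv_inv, FreeGroup.norm, haa]
    rfl
  have hne' : (letterElt a)⁻¹ * (letterElt a)⁻¹ ≠ 1 := by
    rw [ne_eq, ← FreeGroup.norm_eq_zero, hnorm]; simp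
  have hBm : ∀ x, x ∈ B ↔ x.letter 0 = (a.1, !a.2) := fun x => by
    rw [hB, letterElt_inv, mem_cyl_letterElt]
  have htr : ∀ x, translate (letterElt a) x ∈ B ↔ x ∈ B' := by
    intro x
    have := translate_mem_cyl_mul_iff (x := x) (g := letterElt a)
      (v := (letterElt a)⁻¹ * (letterElt a)⁻¹) (by
        rw [mul_inv_cancel_left, mul_inv_rev, inv_inv, haa, toWord_letterElt]; rfl)
    rwa [mul_inv_cancel_left] at this
  have hsub : B ×ˢ X ⊆ apexAt S 0 := by
    rintro ⟨x, y⟩ ⟨hx, hy⟩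
    refine ⟨fun i hi => absurd hi (by omega), ?_⟩
    simp only
    rw [(hBm x).1 hx, hXa hy]
    exact hflip
  have hsub' : B' ×ˢ (translate (letterElt a) ⁻¹' X) ⊆ apexAt S 0 := by
    rintro ⟨x, y⟩ ⟨hx, hy⟩
    refine ⟨fun i hi => absurd hi (by omega), ?_⟩
    have h1 := head?_eq_of_mem_cyl hne' hx
    have h2 : ((letterElt a)⁻¹ * (letterElt a)⁻¹).toWord.head? = some (a.1, !a.2) := by
      rw [← mul_inv_rev, FreeGroup.toWord_inv, haa]; rfl
    have h3 : translate (letterElt a) y ∈ cyl (letterElt a) := mem_cyl_letterElt.2 (hXa hy)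
    rw [translate_mem_cyl_self_iff, letterElt_inv, toWord_letterElt] at h3
    rw [h2] at h1
    intro he
    simp only at he
    exact h3 (by rw [← he]; exact h1)
  have hpre : doubleBoundaryMap (MulAut.conj (letterElt a)) ⁻¹' {p | p.1.1 ∈ B ∧ p.1.2 ∈ X} =
      {p | p.1.1 ∈ B' ∧ p.1.2 ∈ translate (letterElt a) ⁻¹' X} := by
    ext p
    exact and_congr (htr _) Iff.rfl
  have hm : MeasurableSet {p : DoubleBoundary S | p.1.1 ∈ B ∧ p.1.2 ∈ X} :=
    (measurable_fst_end (measurableSet_cyl _)).inter (measurable_snd_end hX)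
  have key := uniformCurrent_preimage_conj (letterElt a) hm
  rw [hpre, uniformCurrent_prod (measurableSet_cyl _) (measurable_translate _ hX) hsub',
    uniformCurrent_prod (measurableSet_cyl _) hX hsub,
    ENNReal.ofReal_eq_ofReal_iff (by positivity) (by positivity), uniformMeasure_cyl hne,
    uniformMeasure_cyl hne', hnorm, FreeGroup.norm_inv_eq, norm_letterElt] at key
  simp only [mul_zero, pow_zero, mul_one, le_refl, tsub_eq_zero_of_le, Nat.add_one_sub_one,
    pow_one] at key
  field_simp at key
  linarith

/-- The harmonic measure of `U` seen from the vertex `v`. -/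
noncomputable def harmonic (U : Set (Boundary S)) (v : FreeGroup S) : ℝ :=
  (uniformMeasure S).real {x | translate v x ∈ U}

/-- The part of the harmonic measure of `U` seen from `v` in the direction of the letter `c`. -/
noncomputable def harmonicPart (U : Set (Boundary S)) (v : FreeGroup S) (c : S × Bool) : ℝ :=
  (uniformMeasure S).real {x | x.letter 0 = c ∧ translate v x ∈ U}

theorem measurableSet_letter_translate {U : Set (Boundary S)} (hU : MeasurableSet U)
    (v : FreeGroup S) (c : S × Bool) :
    MeasurableSet {x : Boundary S | x.letter 0 = c ∧ translate v x ∈ U} :=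
  (measurableSet_letter 0 c).inter (measurable_translate v hU)

theorem harmonic_eq_sum {U : Set (Boundary S)} (hU : MeasurableSet U) (v : FreeGroup S) :
    harmonic U v = ∑ c, harmonicPart U v c := by
  have h : {x : Boundary S | translate v x ∈ U} =
      ⋃ c ∈ (Finset.univ : Finset (S × Bool)), {x | x.letter 0 = c ∧ translate v x ∈ U} := by
    ext x; simp
  rw [harmonic, h, measureReal_biUnion_finset]
  · rfl
  · intro c _ d _ hcd
    rw [Function.onFun, Set.disjoint_left]
    rintro x ⟨h1, -⟩ ⟨h2, -⟩
    exact hcd (h1.symm.trans h2)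
  · exact fun c _ => measurableSet_letter_translate hU v c

theorem harmonicPart_nonneg (U : Set (Boundary S)) (v : FreeGroup S) (c : S × Bool) :
    0 ≤ harmonicPart U v c := measureReal_nonneg

theorem harmonicPart_le (U : Set (Boundary S)) (v : FreeGroup S) (c : S × Bool) :
    harmonicPart U v c ≤ 1 / (branching S + 1) := by
  rw [← uniformMeasure_letter c]
  exact measureReal_mono fun x hx => hx.1

theorem harmonicPart_compl {U : Set (Boundary S)} (hU : MeasurableSet U) (v : FreeGroup S)
    (c : S × Bool) : harmonicPart Uᶜ v c = 1 / (branching S + 1) - harmonicPart U v c := by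
  rw [← uniformMeasure_letter c, eq_sub_iff_add_eq, harmonicPart, harmonicPart,
    ← measureReal_union]
  · congr 1
    ext x
    simp only [Set.mem_union, Set.mem_ofPred_eq, Set.mem_compl_iff]
    tauto
  · rw [Set.disjoint_left]
    rintro x ⟨-, h1⟩ ⟨-, h2⟩
    exact h1 h2
  · exact measurableSet_letter_translate hU v c

/-- Rays at v leaving through a are the rays at va that do not turn back, with measure scaled by q.
The rays at va that turn back have total mass 1/(q+1), which is the uncertainty. -/
theorem harmonic_mul_letter_mem_Icc {U : Set (Boundary S)} (hU : MeasurableSet U)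
    (v : FreeGroup S) (a : S × Bool) :
    harmonic U (v * letterElt a) ∈ Set.Icc (branching S * harmonicPart U v a)
      (branching S * harmonicPart U v a + 1 / (branching S + 1)) := by
  rw [harmonicPart, ← uniformMeasure_preimage_translate_letter a
    (measurableSet_letter_translate hU v a) fun x hx => hx.1]
  constructor
  · refine measureReal_mono fun x hx => ?_
    rw [Set.mem_ofPred_eq, translate_mul]
    exact hx.2
  · rw [← uniformMeasure_letter (a.1, !a.2)]
    refine (measureReal_mono fun x hx => ?_).trans (measureReal_union_le _ _)
    rw [Set.mem_ofPred_eq, translate_mul] at hx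
    by_cases hxa : x.letter 0 = (a.1, !a.2)
    · exact Or.inr hxa
    · refine Or.inl ⟨?_, hx⟩
      rw [← mem_cyl_letterElt, translate_mem_cyl_self_iff, letterElt_inv, toWord_letterElt]
      exact fun h => hxa (Option.some.inj h).symm

/-- The geodesics whose vertex closest to `1` is `v`. -/
def apexSet (v : FreeGroup S) : Set (DoubleBoundary S) :=
  {p | p.1.1 ∈ cyl v ∧ p.1 ∈ apexAt S v.norm}

theorem disjoint_apexSet {v w : FreeGroup S} (h : v ≠ w) : Disjoint (apexSet v) (apexSet w) := by
  rw [Set.disjoint_left]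
  rintro p ⟨h1, h2⟩ ⟨h3, h4⟩
  have h5 : v.norm = w.norm := by
    by_contra hne
    exact Set.disjoint_left.1 (disjoint_apexAt hne) h2 h4
  rw [mem_cyl_iff_take] at h1 h3
  exact h (by rw [← h1, ← h3, h5])

theorem measurableSet_apexSet (v : FreeGroup S) : MeasurableSet (apexSet v) :=
  (measurable_fst_end (measurableSet_cyl v)).inter
    (measurableEmbedding_val.measurable (measurableSet_apexAt _))

/-- Translation by v carries pairs of rays leaving 1 through c and d to geodesics with apex v, as
neither letter cancels into v. At depth 0 the current is the product measure up to the factor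
(q+1)/q. -/
theorem le_uniformCurrent_apexSet {U : Set (Boundary S)} (hU : MeasurableSet U)
    {v : FreeGroup S} {c d : S × Bool} (hcd : c ≠ d) (hc : v⁻¹.toWord.head? ≠ some c)
    (hd : v⁻¹.toWord.head? ≠ some d) :
    ENNReal.ofReal ((branching S + 1) / branching S *
        ((1 / (branching S + 1) - harmonicPart U v c) * harmonicPart U v d)) ≤
      uniformCurrent S (apexSet v ∩ {p | p.1.1 ∉ U ∧ p.1.2 ∈ U}) := by
  have hsub : {x : Boundary S | x.letter 0 = c ∧ translate v x ∈ Uᶜ} ×ˢ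
      {x : Boundary S | x.letter 0 = d ∧ translate v x ∈ U} ⊆ apexAt S 0 := by
    rintro ⟨x, y⟩ ⟨hx, hy⟩
    refine ⟨fun i hi => absurd hi (by omega), ?_⟩
    simp only
    rw [hx.1, hy.1]
    exact hcd
  have h1 := uniformCurrent_prod (measurableSet_letter_translate hU.compl v c)
    (measurableSet_letter_translate hU v d) hsub
  rw [mul_zero, pow_zero, mul_one] at h1
  have hm : MeasurableSet (apexSet v ∩ {p | p.1.1 ∉ U ∧ p.1.2 ∈ U}) :=
    (measurableSet_apexSet v).inter
      ((measurable_fst_end hU.compl).inter (measurable_snd_end hU))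
  rw [← harmonicPart_compl hU, harmonicPart, harmonicPart, ← h1,
    ← uniformCurrent_preimage_conj v hm]
  refine measure_mono ?_
  rintro p ⟨⟨h2, h3⟩, h4, h5⟩
  have hx : v⁻¹.toWord.head? ≠ some (p.1.1.letter 0) := by rwa [h2]
  have hy : v⁻¹.toWord.head? ≠ some (p.1.2.letter 0) := by rwa [h4]
  refine ⟨⟨translate_mem_cyl_self_iff.2 hx, fun i hi => ?_, ?_⟩, h3, h5⟩
  · rw [doubleBoundaryMap_conj_fst, doubleBoundaryMap_conj_snd]
    exact Option.some.inj
      ((translate_letter_of_lt hx hi).symm.trans (translate_letter_of_lt hy hi))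
  · rw [doubleBoundaryMap_conj_fst, doubleBoundaryMap_conj_snd]
    have hx0 := translate_letter_add hx 0
    have hy0 := translate_letter_add hy 0
    rw [Nat.add_zero] at hx0 hy0
    rw [hx0, hy0, h2, h4]
    exact hcd

theorem card_letters : (Fintype.card (S × Bool) : ℝ) = branching S + 1 := by
  rw [cast_branching, Fintype.card_prod, Fintype.card_bool]
  push_cast
  ring

theorem exists_letter_ne_ne (h3 : 3 ≤ branching S) (c : S × Bool) (o : Option (S × Bool)) :
    ∃ l : S × Bool, l ≠ c ∧ o ≠ some l := by
  by_contra! h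
  have hsub : (Finset.univ : Finset (S × Bool)) ⊆ {c, o.getD c} := by
    intro l _
    by_cases hl : l = c
    · simp [hl]
    · simp [h l hl]
  have h1 := (Finset.card_le_card hsub).trans Finset.card_le_two
  rw [Finset.card_univ, Fintype.card_prod, Fintype.card_bool] at h1
  rw [branching] at h3
  omega

theorem sum_ite_head_le (o : Option (S × Bool)) :
    ∑ c : S × Bool, (if o = some c then (1 : ℝ) else 0) ≤ 1 := by
  rcases o with _ | a <;> simp

/-- If the harmonic measure of `U` crosses the value `1 / 2` along an edge going away from `1`
with origin `v`, then a definite mass of geodesics from the complement of `U` to `U` has apex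
`v`. -/
theorem le_uniformCurrent_of_crossing (h3 : 3 ≤ branching S) {U : Set (Boundary S)}
    (hU : MeasurableSet U) {v : FreeGroup S} {a : S × Bool} (ha : v⁻¹.toWord.head? ≠ some a)
    (hcross : (harmonic U v ≤ 1 / 2 ∧ 1 / 2 ≤ harmonic U (v * letterElt a)) ∨
      (1 / 2 ≤ harmonic U v ∧ harmonic U (v * letterElt a) ≤ 1 / 2)) :
    ENNReal.ofReal (1 / (64 * branching S * (branching S + 1))) ≤
      uniformCurrent S (apexSet v ∩ {p | p.1.1 ∉ U ∧ p.1.2 ∈ U}) := by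
  have h3' : (3 : ℝ) ≤ branching S := by exact_mod_cast h3
  set q : ℝ := ((branching S : ℕ) : ℝ) with hq
  -- β c is the probability of ending in U, given that the ray leaves v through c.
  set β : S × Bool → ℝ := fun c => (q + 1) * harmonicPart U v c with hβ
  have hα : ∀ c, harmonicPart U v c = β c / (q + 1) := fun c => by
    simp only [hβ]; field_simp
  have hβ0 : ∀ c, 0 ≤ β c := fun c => mul_nonneg (by linarith) (harmonicPart_nonneg U v c)
  have hβ1 : ∀ c, β c ≤ 1 := fun c => by
    have := harmonicPart_le U v c
    rw [hα, ← hq, div_le_div_iff_of_pos_right (by linarith)] at this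
    exact this
  have key : ∀ c d, c ≠ d → v⁻¹.toWord.head? ≠ some c → v⁻¹.toWord.head? ≠ some d →
      1 / 64 ≤ (1 - β c) * β d →
      ENNReal.ofReal (1 / (64 * q * (q + 1))) ≤
        uniformCurrent S (apexSet v ∩ {p | p.1.1 ∉ U ∧ p.1.2 ∈ U}) := by
    intro c d hcd hc hd h
    refine le_trans (ENNReal.ofReal_le_ofReal ?_) (le_uniformCurrent_apexSet hU hcd hc hd)
    rw [hα, hα, ← hq]
    have : (q + 1) / q * ((1 / (q + 1) - β c / (q + 1)) * (β d / (q + 1))) =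
        ((1 - β c) * β d) / (q * (q + 1)) := by
      field_simp
    rw [this, show 1 / (64 * q * (q + 1)) = (1 / 64) / (q * (q + 1)) by field_simp]
    gcongr
  by_contra hcon
  have key' : ∀ c d, c ≠ d → v⁻¹.toWord.head? ≠ some c → v⁻¹.toWord.head? ≠ some d →
      (1 - β c) * β d < 1 / 64 := fun c d h1 h2 h4 => by
    by_contra! h
    exact hcon (key c d h1 h2 h4 h)
  have hsum : harmonic U v = (∑ c, β c) / (q + 1) := by
    rw [harmonic_eq_sum hU, Finset.sum_div]
    exact Finset.sum_congr rfl fun c _ => hα c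
  have hhead := sum_ite_head_le v⁻¹.toWord.head?
  have hcard : ∀ t : ℝ, ∑ _c : S × Bool, t = (q + 1) * t := fun t => by
    rw [Finset.sum_const, Finset.card_univ, nsmul_eq_mul, card_letters]
  obtain ⟨hlo, hhi⟩ := harmonic_mul_letter_mem_Icc hU v a
  rw [hα, ← hq] at hlo hhi
  have hqq : 1 / (q + 1) ≤ 1 / 4 := by
    rw [div_le_div_iff_of_pos_left] <;> linarith
  have hqd : q * (β a / (q + 1)) = β a - β a * (1 / (q + 1)) := by field_simp; ring
  -- A forward c with β c ≥ 1/8 and a different forward d with β d ≤ 7/8 give a product of at least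
  -- 1/64, which is excluded. If c = d, a further forward letter l, available because q ≥ 3, would
  -- need both β l < 1/8 and β l > 7/8.
  have hdich : (∀ c, v⁻¹.toWord.head? ≠ some c → β c < 1 / 8) ∨
      (∀ c, v⁻¹.toWord.head? ≠ some c → 7 / 8 < β c) := by
    by_contra! h
    obtain ⟨⟨c, hc, hc8⟩, d, hd, hd8⟩ := h
    by_cases hcd : c = d
    · subst hcd
      obtain ⟨l, hl, hl'⟩ := exists_letter_ne_ne h3 c v⁻¹.toWord.head?
      have h1 := key' c l hl.symm hc hl'
      have h2 := key' l c hl hl' hc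
      have h5 := hβ0 l
      have h6 := hβ1 l
      nlinarith
    · have h1 := key' d c (Ne.symm hcd) hd hc
      nlinarith
  rcases hdich with hsmall | hlarge
  · have h1 : ∑ c, β c ≤ (q + 1) * (1 / 8) + 1 := by
      refine le_trans (Finset.sum_le_sum (g := fun c =>
        1 / 8 + if v⁻¹.toWord.head? = some c then (1 : ℝ) else 0) fun c _ => ?_) ?_
      · split_ifs with h
        · linarith [hβ1 c]
        · linarith [hsmall c h]
      · rw [Finset.sum_add_distrib, hcard]
        linarith
    have h2 : harmonic U v ≤ 1 / 8 + 1 / (q + 1) := by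
      rw [hsum, div_le_iff₀ (by linarith)]
      field_simp at h1 ⊢
      linarith
    have h4 := hsmall a ha
    have h5 : 0 ≤ β a * (1 / (q + 1)) := mul_nonneg (hβ0 a) (by positivity)
    rcases hcross with ⟨h6, h7⟩ | ⟨h6, h7⟩ <;> linarith
  · have h1 : (q + 1) * (7 / 8) - 1 ≤ ∑ c, β c := by
      refine le_trans ?_ (Finset.sum_le_sum (f := fun c =>
        7 / 8 - if v⁻¹.toWord.head? = some c then (1 : ℝ) else 0) fun c _ => ?_)
      · rw [Finset.sum_sub_distrib, hcard]
        linarith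
      · split_ifs with h
        · linarith [hβ0 c]
        · linarith [hlarge c h]
    have h2 : 7 / 8 - 1 / (q + 1) ≤ harmonic U v := by
      rw [hsum, le_div_iff₀ (by linarith)]
      field_simp at h1 ⊢
      linarith
    have h4 := hlarge a ha
    have h5 : β a * (1 / (q + 1)) ≤ β a * (1 / 4) :=
      mul_le_mul_of_nonneg_left hqq (hβ0 a)
    rcases hcross with ⟨h6, h7⟩ | ⟨h6, h7⟩ <;> linarith

end

section

variable {S : Type*} [DecidableEq S] [Fintype S] [Nonempty S]

/-! ### The length of an automorphism -/

theorem doubleBoundaryMap_mul (Φ Ψ : MulAut (FreeGroup S)) :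
    doubleBoundaryMap (Φ * Ψ) = doubleBoundaryMap Φ ∘ doubleBoundaryMap Ψ := by
  ext1 p
  exact Subtype.ext (Prod.ext (boundaryMap_mul _ _ _) (boundaryMap_mul _ _ _))

theorem baseBall_eq : baseBall S = Subtype.val ⁻¹' apexAt S 0 := by
  ext p
  rw [mem_baseBall_iff]
  simp [apexAt]

theorem measurableSet_baseBall : MeasurableSet (baseBall S) := by
  rw [baseBall_eq]
  exact measurableEmbedding_val.measurable (measurableSet_apexAt 0)

theorem autLength_eq (η : Measure (DoubleBoundary S)) (Φ : MulAut (FreeGroup S)) :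
    autLength η Φ = η.real (doubleBoundaryMap Φ ⁻¹' baseBall S) := by
  rw [autLength, currentLength, map_measureReal_apply (measurable_doubleBoundaryMap Φ)
    measurableSet_baseBall]

/-- Rays agreeing for N letters have images with the same first letter, so a geodesic whose image
passes through 1 branches at depth below N, and each depth has finite mass. -/
theorem uniformCurrent_preimage_baseBall_ne_top (Φ : MulAut (FreeGroup S)) :
    uniformCurrent S (doubleBoundaryMap Φ ⁻¹' baseBall S) ≠ ⊤ := by
  obtain ⟨N, hN⟩ := exists_boundaryMap_letter_eq Φ 1
  have hsub : doubleBoundaryMap Φ ⁻¹' baseBall S ⊆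
      ⋃ n ∈ Finset.range N, Subtype.val ⁻¹' apexAt S n := by
    intro p hp
    rw [Set.mem_preimage, mem_baseBall_iff] at hp
    obtain ⟨n, hn⟩ := exists_mem_apexAt p.2
    simp only [Finset.mem_range, Set.mem_iUnion, Set.mem_preimage, exists_prop]
    refine ⟨n, ?_, hn⟩
    by_contra! hle
    exact hp (hN p.1.1 p.1.2 (fun i hi => hn.1 i (by omega)) 0 one_pos)
  refine ((measure_mono hsub).trans_lt
    ((measure_biUnion_finset_le _ _).trans_lt (ENNReal.sum_lt_top.2 fun n _ => ?_))).ne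
  rw [uniformCurrent_apply_of_subset (measurableSet_apexAt n) subset_rfl]
  exact ENNReal.mul_lt_top ENNReal.ofReal_lt_top (measure_lt_top _ _)

/-- The inner automorphism moves to the right of Φ, as conjugation by Φ⁻¹(g), and is absorbed by the
invariance of the current. -/
theorem autLength_conj_mul (g : FreeGroup S) (Φ : MulAut (FreeGroup S)) :
    autLength (uniformCurrent S) (MulAut.conj g * Φ) = autLength (uniformCurrent S) Φ := by
  have h : MulAut.conj g * Φ = Φ * MulAut.conj (Φ⁻¹ g) := by
    ext x
    simp
  rw [h, autLength, autLength, doubleBoundaryMap_mul,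
    ← Measure.map_map (measurable_doubleBoundaryMap _) (measurable_doubleBoundaryMap _),
    uniformCurrent_map_conj]

/-! ### Balanced automorphisms -/

/-- The set of rays whose image under `Φ` starts with the letter `b`. -/
def firstLetterSet (Φ : MulAut (FreeGroup S)) (b : S × Bool) : Set (Boundary S) :=
  {x | (boundaryMap Φ x).letter 0 = b}

theorem measurableSet_firstLetterSet (Φ : MulAut (FreeGroup S)) (b : S × Bool) :
    MeasurableSet (firstLetterSet Φ b) :=
  measurable_boundaryMap Φ (measurableSet_letter 0 b)

/-- An automorphism is balanced if the vertex `1` is a barycenter of the image of the uniform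
measure. -/
def IsBalanced (Φ : MulAut (FreeGroup S)) : Prop :=
  ∀ b, (uniformMeasure S).real (firstLetterSet Φ b) ≤ 1 / 2

/-- Φ⁻¹ sends a sufficiently small cylinder into a single first-letter cylinder. -/
theorem exists_preimage_cyl_le (Φ : MulAut (FreeGroup S)) :
    ∃ N, ∀ y : FreeGroup S, N ≤ y.norm →
      (uniformMeasure S).real (boundaryMap Φ ⁻¹' cyl y) ≤ 1 / (branching S + 1) := by
  obtain ⟨N, hN⟩ := exists_boundaryMap_letter_eq Φ⁻¹ 1
  refine ⟨N, fun y hy => ?_⟩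
  obtain ⟨z, hz⟩ := exists_mem_cyl y
  rw [← uniformMeasure_letter ((boundaryMap Φ⁻¹ z).letter 0)]
  refine measureReal_mono fun x hx => ?_
  rw [Set.mem_preimage, mem_cyl_iff_getElem?] at hx
  rw [mem_cyl_iff_getElem?] at hz
  have := hN (boundaryMap Φ x) z (fun i hi => Option.some.inj
    ((hx i (by omega)).symm.trans (hz i (by omega)))) 0 one_pos
  rwa [boundaryMap_inv_boundaryMap] at this

/-- The barycenter is a deepest vertex x whose cylinder still carries at least half of Φ_*μ; it
exists because deep cylinders have mass at most 1/(q+1) < 1/2. Seen from x, the direction back to 1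
has at most the complementary half, and every other direction is the cylinder of a longer word. -/
theorem exists_isBalanced (h3 : 3 ≤ branching S) (Φ : MulAut (FreeGroup S)) :
    ∃ g, IsBalanced (MulAut.conj g * Φ) := by
  have h3' : (3 : ℝ) ≤ branching S := by exact_mod_cast h3
  obtain ⟨N, hN⟩ := exists_preimage_cyl_le Φ
  set m : FreeGroup S → ℝ := fun y => (uniformMeasure S).real (boundaryMap Φ ⁻¹' cyl y) with hm
  have hlt : ∀ y, 1 / 2 ≤ m y → y.norm ≤ N := by
    intro y hy
    by_contra! h
    have h1 := hy.trans (hN y h.le)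
    rw [div_le_div_iff₀ (by norm_num) (by linarith)] at h1
    linarith
  have hbdd : BddAbove (FreeGroup.norm '' {y | 1 / 2 ≤ m y}) := ⟨N, by
    rintro _ ⟨y, hy, rfl⟩
    exact hlt y hy⟩
  have hne : (FreeGroup.norm '' {y | 1 / 2 ≤ m y}).Nonempty := by
    refine ⟨_, 1, ?_, rfl⟩
    simp only [hm, Set.mem_ofPred_eq, cyl_one, Set.preimage_univ, probReal_univ]
    norm_num
  obtain ⟨x, hx, hxn⟩ := Nat.sSup_mem hne hbdd
  have hmax : ∀ y, 1 / 2 ≤ m y → y.norm ≤ x.norm := fun y hy => by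
    rw [hxn]
    exact le_csSup hbdd ⟨y, hy, rfl⟩
  refine ⟨x⁻¹, fun b => ?_⟩
  have hb : ∀ z, z ∈ firstLetterSet (MulAut.conj x⁻¹ * Φ) b ↔
      translate x⁻¹ (boundaryMap Φ z) ∈ cyl (letterElt b) := by
    intro z
    rw [mem_cyl_letterElt, firstLetterSet, Set.mem_ofPred_eq, boundaryMap_mul]
    rfl
  by_cases hxb : x⁻¹.toWord.head? = some b
  · have hsub : firstLetterSet (MulAut.conj x⁻¹ * Φ) b ⊆ (boundaryMap Φ ⁻¹' cyl x)ᶜ := by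
      intro z hz hzx
      rw [hb, mem_cyl_letterElt] at hz
      rw [Set.mem_preimage, ← translate_translate_inv x (boundaryMap Φ z),
        translate_mem_cyl_self_iff, hz] at hzx
      exact hzx hxb
    refine (measureReal_mono hsub).trans ?_
    rw [probReal_compl_eq_one_sub (measurable_boundaryMap Φ (measurableSet_cyl x))]
    have : 1 / 2 ≤ m x := hx
    linarith
  · have hw : (x * letterElt b).toWord = x.toWord ++ [b] :=
      toWord_mul_mk_of_head? FreeGroup.IsReduced.singleton fun c hc => by
        simp only [List.head?_cons, Option.mem_some_iff] at hc
        rwa [← hc]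
    have hhead : (x * letterElt b)⁻¹.toWord.head? = (letterElt b)⁻¹.toWord.head? := by
      rw [head?_toWord_inv, head?_toWord_inv, hw, toWord_letterElt]
      simp
    have hset : firstLetterSet (MulAut.conj x⁻¹ * Φ) b =
        boundaryMap Φ ⁻¹' cyl (x * letterElt b) := by
      ext z
      rw [hb, ← translate_mem_cyl_mul_iff hhead, translate_translate_inv]
      rfl
    rw [hset]
    by_contra! hgt
    have h1 := hmax (x * letterElt b) hgt.le
    rw [FreeGroup.norm, FreeGroup.norm, hw, List.length_append] at h1
    simp at h1

theorem mem_firstLetterSet_translate (Φ : MulAut (FreeGroup S)) (b : S × Bool)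
    (g : FreeGroup S) (x : Boundary S) :
    translate (Φ⁻¹ g) x ∈ firstLetterSet Φ b ↔
      (translate g (boundaryMap Φ x)).letter 0 = b := by
  rw [firstLetterSet, Set.mem_ofPred_eq, boundaryMap_translate, MulAut.apply_inv_self]

/-- Seen from this vertex, landing in the set means that Φ(x) starts with the initial segment of w
ending in this b, hence with the first letter of w. Balancedness bounds the probability of that. -/
theorem IsBalanced.harmonic_le {Φ : MulAut (FreeGroup S)} (hΦ : IsBalanced Φ)
    {w : FreeGroup S} {i : ℕ} {b : S × Bool} (hb : w.toWord[i]? = some b) :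
    harmonic (firstLetterSet Φ b) (Φ⁻¹ (initSeg w i)⁻¹) ≤ 1 / 2 := by
  obtain ⟨c, hc⟩ : ∃ c, w.toWord.head? = some c := by
    cases h : w.toWord with
    | nil => simp [h] at hb
    | cons c t => exact ⟨c, rfl⟩
  refine le_trans (measureReal_mono fun x hx => ?_) (hΦ c)
  rw [Set.mem_ofPred_eq, mem_firstLetterSet_translate, ← mem_cyl_letterElt] at hx
  have hi : i < w.toWord.length := (List.getElem?_eq_some_iff.1 hb).1
  have htake : w.toWord.take (i + 1) = w.toWord.take i ++ [b] := by
    rw [List.take_add_one, hb]; rfl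
  have hmul : initSeg w i * letterElt b = initSeg w (i + 1) := by
    rw [initSeg, initSeg, htake, FreeGroup.mul_mk]
  have hhead : (initSeg w i * letterElt b)⁻¹.toWord.head? = (letterElt b)⁻¹.toWord.head? := by
    rw [hmul, head?_toWord_inv, head?_toWord_inv, toWord_initSeg, htake, toWord_letterElt]
    simp
  rw [← translate_mem_cyl_mul_iff hhead, translate_translate_inv, hmul] at hx
  have hne : initSeg w (i + 1) ≠ 1 := by
    rw [ne_eq, ← FreeGroup.norm_eq_zero, norm_initSeg (by rw [FreeGroup.norm]; omega)]
    omega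
  have h1 := head?_eq_of_mem_cyl hne hx
  rw [toWord_initSeg, List.head?_take, if_neg (by omega), hc] at h1
  exact (Option.some.inj h1).symm

/-- Let z be the part of w from this b on, and c the first letter of z⁻¹. If Φ(x) does not start
with c, there is no complete cancellation and z Φ(x) starts with b. Balancedness gives this event
probability at least 1/2. -/
theorem IsBalanced.le_harmonic {Φ : MulAut (FreeGroup S)} (hΦ : IsBalanced Φ)
    {w : FreeGroup S} {i : ℕ} {b : S × Bool} (hb : w.toWord[i]? = some b) :
    1 / 2 ≤ harmonic (firstLetterSet Φ b) (Φ⁻¹ ((initSeg w i)⁻¹ * w)) := by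
  have hi : i < w.toWord.length := (List.getElem?_eq_some_iff.1 hb).1
  set z := (initSeg w i)⁻¹ * w with hz
  have hzw : z.toWord = w.toWord.drop i := by
    have : z = FreeGroup.mk (w.toWord.drop i) := by
      rw [hz, inv_mul_eq_iff_eq_mul, initSeg, FreeGroup.mul_mk, List.take_append_drop,
        FreeGroup.mk_toWord]
    rw [this]
    exact toWord_mk_of_isReduced
      (FreeGroup.isReduced_toWord.infix (List.drop_suffix i _).isInfix)
  have hzb : z.toWord.head? = some b := by rw [hzw, List.head?_drop, hb]
  have hz1 : z ≠ 1 := by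
    rintro h
    rw [h] at hzb
    simp at hzb
  obtain ⟨c, hc⟩ : ∃ c, z⁻¹.toWord.head? = some c := by
    rw [head?_toWord_inv, hzw]
    cases h : (w.toWord.drop i).getLast? with
    | none => simp at h; omega
    | some d => exact ⟨_, rfl⟩
  have hsub : (firstLetterSet Φ c)ᶜ ⊆ {x | translate (Φ⁻¹ z) x ∈ firstLetterSet Φ b} := by
    intro x hx
    rw [Set.mem_ofPred_eq, mem_firstLetterSet_translate]
    have h1 : translate z (boundaryMap Φ x) ∈ cyl z := by
      rw [translate_mem_cyl_self_iff, hc]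
      exact fun h => hx (Option.some.inj h).symm
    have h2 := head?_eq_of_mem_cyl hz1 h1
    rw [hzb] at h2
    exact (Option.some.inj h2).symm
  refine le_trans ?_ (measureReal_mono hsub)
  rw [probReal_compl_eq_one_sub (measurableSet_firstLetterSet Φ c)]
  linarith [hΦ c]

theorem head?_toWord_letterElt_inv_mul {g : FreeGroup S} {a : S × Bool}
    (h : g.toWord.head? = some a) :
    ((letterElt a)⁻¹ * g).toWord.head? ≠ some (a.1, !a.2) := by
  obtain ⟨t, ht⟩ : ∃ t, g.toWord = a :: t := by
    cases hg : g.toWord with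
    | nil => simp [hg] at h
    | cons c t =>
      rw [hg] at h
      exact ⟨t, by rw [Option.some.inj h]⟩
  have hred : FreeGroup.IsReduced (a :: t) := ht ▸ FreeGroup.isReduced_toWord
  have hg : (letterElt a)⁻¹ * g = FreeGroup.mk t := by
    rw [inv_mul_eq_iff_eq_mul, FreeGroup.mul_mk, ← FreeGroup.mk_toWord (x := g), ht]
    rfl
  rw [hg, toWord_mk_of_isReduced (hred.infix (List.suffix_cons a t).isInfix)]
  intro hc
  cases t with
  | nil => simp at hc
  | cons c s =>
    rw [List.head?_cons, Option.some.injEq] at hc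
    subst hc
    simp [FreeGroup.isReduced_cons_cons] at hred

/-! ### The length bounds the size of a balanced automorphism -/

/-- The vertices that are the apex of a definite mass of geodesics whose image under `Φ` passes
through `1` with outgoing letter `b`. -/
def heavyApexes (Φ : MulAut (FreeGroup S)) (b : S × Bool) : Set (FreeGroup S) :=
  {v | ENNReal.ofReal (1 / (64 * branching S * (branching S + 1))) ≤
    uniformCurrent S
      (apexSet v ∩ {p | p.1.1 ∉ firstLetterSet Φ b ∧ p.1.2 ∈ firstLetterSet Φ b})}

/-- Geodesics with different apexes are disjoint, and if only one end of the image starts with b,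
the image passes through 1. So each heavy apex adds its share to L(Φ). -/
theorem card_le_of_subset_heavyApexes {Φ : MulAut (FreeGroup S)} {b : S × Bool}
    {s : Finset (FreeGroup S)} (hs : (s : Set (FreeGroup S)) ⊆ heavyApexes Φ b) :
    (s.card : ℝ) ≤
      64 * branching S * (branching S + 1) * autLength (uniformCurrent S) Φ := by
  have hq := cast_branching_pos (S := S)
  set E : Set (DoubleBoundary S) :=
    {p | p.1.1 ∉ firstLetterSet Φ b ∧ p.1.2 ∈ firstLetterSet Φ b} with hE
  have hEm : MeasurableSet E :=
    (measurable_fst_end (measurableSet_firstLetterSet Φ b).compl).inter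
      (measurable_snd_end (measurableSet_firstLetterSet Φ b))
  have hEsub : E ⊆ doubleBoundaryMap Φ ⁻¹' baseBall S := by
    rintro p ⟨h1, h2⟩
    rw [Set.mem_preimage, mem_baseBall_iff]
    intro h
    exact h1 (h.trans h2)
  have h1 : ∑ v ∈ s, uniformCurrent S (apexSet v ∩ E) ≤
      uniformCurrent S (doubleBoundaryMap Φ ⁻¹' baseBall S) := by
    rw [← measure_biUnion_finset]
    · refine measure_mono (Set.Subset.trans ?_ hEsub)
      exact Set.iUnion₂_subset fun v _ => Set.inter_subset_right
    · intro v _ w _ hvw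
      exact (disjoint_apexSet hvw).mono Set.inter_subset_left Set.inter_subset_left
    · exact fun v _ => (measurableSet_apexSet v).inter hEm
  have h2 : (s.card : ENNReal) * ENNReal.ofReal (1 / (64 * branching S * (branching S + 1))) ≤
      uniformCurrent S (doubleBoundaryMap Φ ⁻¹' baseBall S) := by
    refine le_trans ?_ h1
    rw [← nsmul_eq_mul]
    exact Finset.card_nsmul_le_sum _ _ _ fun v hv => hs hv
  have h3 := ENNReal.toReal_mono (uniformCurrent_preimage_baseBall_ne_top Φ) h2
  rw [ENNReal.toReal_mul, ENNReal.toReal_natCast, ENNReal.toReal_ofReal (by positivity)] at h3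
  rw [autLength_eq, Measure.real]
  rw [mul_one_div, div_le_iff₀ (by positivity)] at h3
  linarith

theorem finite_heavyApexes (Φ : MulAut (FreeGroup S)) (b : S × Bool) :
    (heavyApexes Φ b).Finite := by
  by_contra hinf
  obtain ⟨N, hN⟩ := exists_nat_gt
    (64 * branching S * (branching S + 1) * autLength (uniformCurrent S) Φ)
  obtain ⟨s, hs, hcard⟩ := Set.Infinite.exists_subset_card_eq hinf N
  have := card_le_of_subset_heavyApexes hs
  rw [hcard] at this
  linarith

theorem IsBalanced.mem_heavyApexes (h3 : 3 ≤ branching S) {Φ : MulAut (FreeGroup S)}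
    (hΦ : IsBalanced Φ) (a : S × Bool) {i : ℕ} {b : S × Bool}
    (hb : (Φ (letterElt a)).toWord[i]? = some b) :
    Φ⁻¹ (initSeg (Φ (letterElt a)) i)⁻¹ ∈ heavyApexes Φ b ∨
      Φ⁻¹ (initSeg (Φ (letterElt a)) i)⁻¹ * letterElt a ∈ heavyApexes Φ b := by
  set w := Φ (letterElt a) with hw
  set v := Φ⁻¹ (initSeg w i)⁻¹ with hv
  have hva : Φ⁻¹ ((initSeg w i)⁻¹ * w) = v * letterElt a := by
    rw [map_mul, hw, MulAut.inv_apply_self]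
  have h1 := hΦ.harmonic_le hb
  have h2 := hΦ.le_harmonic hb
  rw [hva] at h2
  have hU := measurableSet_firstLetterSet Φ b
  -- The crossing lemma wants an edge pointing away from 1. If multiplication by a brings v closer
  -- to 1, the edge is read backwards, from va to v.
  by_cases hhead : v⁻¹.toWord.head? = some a
  · right
    have hinv : v * letterElt a * letterElt (a.1, !a.2) = v := by
      rw [← letterElt_inv, mul_inv_cancel_right]
    refine le_uniformCurrent_of_crossing h3 hU (a := (a.1, !a.2)) ?_ ?_
    · rw [mul_inv_rev]
      exact head?_toWord_letterElt_inv_mul hhead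
    · rw [hinv]
      exact Or.inr ⟨h2, h1⟩
  · exact Or.inl (le_uniformCurrent_of_crossing h3 hU hhead (Or.inl ⟨h1, h2⟩))

/-- Each position of Φ(a) gives a different vertex v, and v or va is heavy for the letter at that
position. The factor 2 accounts for this alternative, and q + 1 counts the letters b. -/
theorem IsBalanced.norm_letter_le (h3 : 3 ≤ branching S) {Φ : MulAut (FreeGroup S)}
    (hΦ : IsBalanced Φ) (a : S × Bool) :
    ((Φ (letterElt a)).norm : ℝ) ≤ (branching S + 1) *
      (2 * (64 * branching S * (branching S + 1) * autLength (uniformCurrent S) Φ)) := by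
  set w := Φ (letterElt a) with hw
  set T : S × Bool → Finset (FreeGroup S) := fun b => (finite_heavyApexes Φ b).toFinset with hT
  set T' : Finset (FreeGroup S) := Finset.univ.biUnion fun b =>
    T b ∪ (T b).image (· * (letterElt a)⁻¹) with hT'
  have hinj : w.norm ≤ T'.card := by
    rw [← Finset.card_range w.norm]
    refine Finset.card_le_card_of_injOn (fun i => Φ⁻¹ (initSeg w i)⁻¹) ?_ ?_
    · intro i hi
      have hi' : i < w.toWord.length := Finset.mem_range.1 hi
      have hb := List.getElem?_eq_getElem hi'
      rw [hT', Finset.mem_coe, Finset.mem_biUnion]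
      refine ⟨w.toWord[i], Finset.mem_univ _, ?_⟩
      rw [Finset.mem_union, Finset.mem_image]
      rcases hΦ.mem_heavyApexes h3 a hb with h | h
      · exact Or.inl ((Set.Finite.mem_toFinset _).2 h)
      · exact Or.inr ⟨_, (Set.Finite.mem_toFinset _).2 h, mul_inv_cancel_right _ _⟩
    · intro i hi j hj hij
      have h1 : initSeg w i = initSeg w j := inv_injective (Φ⁻¹.injective hij)
      have hi' := Finset.mem_range.1 hi
      have hj' := Finset.mem_range.1 hj
      rw [← norm_initSeg hi'.le, h1, norm_initSeg hj'.le]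
  have hcard : T'.card ≤ ∑ b, 2 * (T b).card := by
    refine Finset.card_biUnion_le.trans (Finset.sum_le_sum fun b _ => ?_)
    refine (Finset.card_union_le _ _).trans ?_
    have := Finset.card_image_le (s := T b) (f := (· * (letterElt a)⁻¹))
    omega
  calc (w.norm : ℝ) ≤ ((∑ b, 2 * (T b).card : ℕ) : ℝ) := by exact_mod_cast hinj.trans hcard
    _ = ∑ b, 2 * ((T b).card : ℝ) := by push_cast; rfl
    _ ≤ ∑ _b : S × Bool,
        2 * (64 * branching S * (branching S + 1) * autLength (uniformCurrent S) Φ) := by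
      refine Finset.sum_le_sum fun b _ => ?_
      have : (T b : Set (FreeGroup S)) ⊆ heavyApexes Φ b := by
        rw [hT, Set.Finite.coe_toFinset]
      linarith [card_le_of_subset_heavyApexes this]
    _ = _ := by rw [Finset.sum_const, Finset.card_univ, nsmul_eq_mul, card_letters]

/-! ### Finiteness of the spectrum below a bound -/

theorem finite_norm_le (B : ℕ) : {g : FreeGroup S | g.norm ≤ B}.Finite :=
  Set.Finite.of_finite_image
    ((List.finite_length_le (S × Bool) B).subset (by
      rintro _ ⟨g, hg, rfl⟩
      exact hg)) FreeGroup.toWord_injective.injOn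

theorem finite_norm_letter_le (B : ℕ) :
    {Φ : MulAut (FreeGroup S) | ∀ a, (Φ (letterElt a)).norm ≤ B}.Finite := by
  have h : (Set.univ.pi fun _ : S => {g : FreeGroup S | g.norm ≤ B}).Finite :=
    Set.Finite.pi fun _ => finite_norm_le B
  refine Set.Finite.of_injOn (f := fun (Φ : MulAut (FreeGroup S)) s => Φ (FreeGroup.of s))
    ?_ ?_ h
  · intro Φ hΦ s _
    exact hΦ (s, true)
  · intro Φ _ Ψ _ hΦΨ
    have : Φ.toMonoidHom = Ψ.toMonoidHom := FreeGroup.ext_hom _ _ fun s => congrFun hΦΨ s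
    exact MulEquiv.toMonoidHom_injective this

theorem finite_range_autLength_inter_Iic (C : ℝ) :
    (Set.range (autLength (uniformCurrent S)) ∩ Set.Iic C).Finite := by
  by_cases h3 : 3 ≤ branching S
  · obtain ⟨B, hB⟩ := exists_nat_ge
      ((branching S + 1) * (2 * (64 * branching S * (branching S + 1) * C)) : ℝ)
    refine ((finite_norm_letter_le (S := S) B).image (autLength (uniformCurrent S))).subset ?_
    rintro _ ⟨⟨Φ, rfl⟩, hC⟩
    obtain ⟨g, hg⟩ := exists_isBalanced h3 Φ
    refine ⟨MulAut.conj g * Φ, fun a => ?_, autLength_conj_mul g Φ⟩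
    have h1 := hg.norm_letter_le h3 a
    rw [autLength_conj_mul] at h1
    have h2 : ((branching S + 1) * (2 * (64 * branching S * (branching S + 1) *
        autLength (uniformCurrent S) Φ)) : ℝ) ≤
        (branching S + 1) * (2 * (64 * branching S * (branching S + 1) * C)) := by
      have : autLength (uniformCurrent S) Φ ≤ C := hC
      gcongr
    exact_mod_cast h1.trans (h2.trans hB)
  -- In rank one a ray is determined by its first letter, so distinct ends always leave 1 by
  -- different letters.
  · have hcard : Fintype.card S ≤ 1 := by
      rw [branching] at h3
      omega
    have hS : Subsingleton S := Fintype.card_le_one_iff_subsingleton.1 hcard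
    have hball : baseBall S = Set.univ := by
      refine Set.eq_univ_of_forall fun p => mem_baseBall_iff.2 fun h => p.2 ?_
      refine Boundary.ext_letter fun i => ?_
      induction i with
      | zero => exact h
      | succ i ih =>
        have h1 := p.1.1.2 i (Subsingleton.elim _ _)
        have h2 := p.1.2.2 i (Subsingleton.elim _ _)
        exact Prod.ext (Subsingleton.elim _ _) (h1.symm.trans ((congrArg Prod.snd ih).trans h2))
    refine (Set.finite_singleton ((uniformCurrent S).real Set.univ)).subset ?_
    rintro _ ⟨⟨Φ, rfl⟩, -⟩
    rw [Set.mem_singleton_iff, autLength_eq, hball, Set.preimage_univ]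

theorem isClosed_and_isDiscrete_of_finite_inter_Iic {A : Set ℝ}
    (h : ∀ C, (A ∩ Set.Iic C).Finite) : IsClosed A ∧ IsDiscrete A := by
  refine isClosed_and_discrete_iff.2 fun x => ?_
  rw [Filter.disjoint_principal_right]
  have hfin : ((A ∩ Set.Iic (x + 1)) \ {x}).Finite := (h (x + 1)).subset Set.sdiff_subset
  have h1 : ((A ∩ Set.Iic (x + 1)) \ {x})ᶜ ∈ 𝓝 x :=
    hfin.isClosed.isOpen_compl.mem_nhds fun hx => hx.2 rfl
  filter_upwards [mem_nhdsWithin_of_mem_nhds h1,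
    mem_nhdsWithin_of_mem_nhds (Iio_mem_nhds (lt_add_one x)), self_mem_nhdsWithin]
    with y hy1 hy2 hy3 hyA
  exact hy1 ⟨⟨hyA, Set.mem_Iic.2 (le_of_lt (Set.mem_Iio.1 hy2))⟩, hy3⟩

end

end FreeCurrents


/-- On the double boundary of a free group of finite rank `k ≥ 1` there is exactly one uniform
current `η`, and the set of lengths `L(Φ) = L(Φ η)`, `Φ ∈ Aut(F)`, is a discrete subset of the
real line, without accumulation points (discrete as a subspace, and closed). -/
theorem corollary1p2 (S : Type*) [Fintype S] [DecidableEq S] [Nonempty S] :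
    ∃ η : Measure (FreeCurrents.DoubleBoundary S),
      FreeCurrents.IsUniformCurrent η ∧
      (∀ η' : Measure (FreeCurrents.DoubleBoundary S),
        FreeCurrents.IsUniformCurrent η' → η' = η) ∧
      IsDiscrete (Set.range (FreeCurrents.autLength η)) ∧
      IsClosed (Set.range (FreeCurrents.autLength η)) := by
  obtain ⟨hclosed, hdiscrete⟩ := FreeCurrents.isClosed_and_isDiscrete_of_finite_inter_Iic
    (FreeCurrents.finite_range_autLength_inter_Iic (S := S))
  exact ⟨FreeCurrents.uniformCurrent S, FreeCurrents.isUniformCurrent_uniformCurrent,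
    fun _ h => h.eq_uniformCurrent, hdiscrete, hclosed⟩
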